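/- Let $p_0,\dots,p_{n-1}$ be points of $\mathbb{R}^2$ (the events, indexed by time), and let $T$ be their decomposition tree: a balanced binary tree of height $\lceil\log_2 n\rceil$ whose leaves, all on the lowest level, are the events in order of time (nodes on each level are paired from left to right, a last unpaired node having a parent of its own), with links between parents and children and between consecutive nodes of each level, with an array giving the leaf of each event, and in which each node $v$ stores the convex hull of its canonical subset $C_v$ (the points at the leaves below $v$): the vertices in clockwise order, beginning with the lexicographically largest one, together with the position of the lexicographically smallest one. For $i\le j<n$ let $w=j-i+1$ be the length of the window $[p_i,p_j]=(p_i,\dots,p_j)$, and let $h$ be the number of vertices of the convex hull of its points. There are a single real-RAM program and a constant $K$, independent of $n$, the points, the tree's layout in memory and the window, such that the following holds whenever $T$ has been precomputed and is stored in memory. Given $i$ and $j$ with $0\le i\le j<n$, the program lists the vertices of the convex hull of $[p_i,p_j]$, each exactly once (as events of the window), in clockwise order beginning with the lexicographically largest, leaves $T$ unchanged, and halts after at most $K\,h\,(1+\log_2 w)^2$ elementary steps. In particular, for $w\ge 2$ the convex hull of the window is computed in $O(h\log^2 w)$ time. Elementary steps are: reading or writing a register or array cell, addition, truncated subtraction and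 halving of natural numbers, addition, subtraction and multiplication of reals, comparisons, and tests in branches and loops. -/

import Mathlib

/-! ### A real RAM with step counting -/

namespace RealRAM

/-- A state of the machine: integer registers, real registers, integer arrays and real arrays.
A fixed program mentions only finitely many registers and arrays. -/
structure State where
  ireg : ℕ → ℕ
  rreg : ℕ → ℝ
  iarr : ℕ → ℕ → ℕ
  rarr : ℕ → ℕ → ℝ

/-- Integer expressions: constants, registers, array cells, addition, truncated subtraction and
halving. -/
inductive IExp : Type
  | const (c : ℕ)
  | reg (r : ℕ)
  | load (a : ℕ) (e : IExp)
  | add (e f : IExp)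
  | sub (e f : IExp)
  | half (e : IExp)

/-- Real expressions: integer constants, registers, array cells, addition, subtraction and
multiplication. There is no rounding. -/
inductive RExp : Type
  | const (c : ℤ)
  | reg (r : ℕ)
  | load (a : ℕ) (e : IExp)
  | add (e f : RExp)
  | sub (e f : RExp)
  | mul (e f : RExp)

/-- Tests: comparisons of integers, comparisons of reals, negation and conjunction. -/
inductive BExp : Type
  | ieq (e f : IExp)
  | ilt (e f : IExp)
  | rlt (e f : RExp)
  | not (b : BExp)
  | and (b c : BExp)

/-- Programs. -/
inductive Prog : Type
  | skip
  | setI (r : ℕ) (e : IExp)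
  | setR (r : ℕ) (e : RExp)
  | storeI (a : ℕ) (idx e : IExp)
  | storeR (a : ℕ) (idx : IExp) (e : RExp)
  | seq (P Q : Prog)
  | ite (b : BExp) (P Q : Prog)
  | while (b : BExp) (P : Prog)

/-- Value of an integer expression. -/
def IExp.val (s : State) : IExp → ℕ
  | .const c => c
  | .reg r => s.ireg r
  | .load a e => s.iarr a (e.val s)
  | .add e f => e.val s + f.val s
  | .sub e f => e.val s - f.val s
  | .half e => e.val s / 2

/-- Number of elementary operations in an integer expression. -/
def IExp.cost : IExp → ℕ
  | .const _ => 1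
  | .reg _ => 1
  | .load _ e => e.cost + 1
  | .add e f => e.cost + f.cost + 1
  | .sub e f => e.cost + f.cost + 1
  | .half e => e.cost + 1

/-- Value of a real expression. -/
noncomputable def RExp.val (s : State) : RExp → ℝ
  | .const c => (c : ℝ)
  | .reg r => s.rreg r
  | .load a e => s.rarr a (e.val s)
  | .add e f => e.val s + f.val s
  | .sub e f => e.val s - f.val s
  | .mul e f => e.val s * f.val s

/-- Number of elementary operations in a real expression. -/
def RExp.cost : RExp → ℕ
  | .const _ => 1
  | .reg _ => 1
  | .load _ e => e.cost + 1
  | .add e f => e.cost + f.cost + 1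
  | .sub e f => e.cost + f.cost + 1
  | .mul e f => e.cost + f.cost + 1

/-- Truth of a test. -/
def BExp.holds (s : State) : BExp → Prop
  | .ieq e f => e.val s = f.val s
  | .ilt e f => e.val s < f.val s
  | .rlt e f => e.val s < f.val s
  | .not b => ¬ b.holds s
  | .and b c => b.holds s ∧ c.holds s

/-- Number of elementary operations in a test. -/
def BExp.cost : BExp → ℕ
  | .ieq e f => e.cost + f.cost + 1
  | .ilt e f => e.cost + f.cost + 1
  | .rlt e f => e.cost + f.cost + 1
  | .not b => b.cost + 1
  | .and b c => b.cost + c.cost + 1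

/-- `Exec P s t s'`: started in `s`, the program `P` halts in `s'` after `t` elementary steps. -/
inductive Exec : Prog → State → ℕ → State → Prop
  | skip (s : State) : Exec .skip s 1 s
  | setI (r : ℕ) (e : IExp) (s : State) :
      Exec (.setI r e) s (e.cost + 1) { s with ireg := Function.update s.ireg r (e.val s) }
  | setR (r : ℕ) (e : RExp) (s : State) :
      Exec (.setR r e) s (e.cost + 1) { s with rreg := Function.update s.rreg r (e.val s) }
  | storeI (a : ℕ) (idx e : IExp) (s : State) :
      Exec (.storeI a idx e) s (idx.cost + e.cost + 1)
        { s with iarr := Function.update s.iarr a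
                    (Function.update (s.iarr a) (idx.val s) (e.val s)) }
  | storeR (a : ℕ) (idx : IExp) (e : RExp) (s : State) :
      Exec (.storeR a idx e) s (idx.cost + e.cost + 1)
        { s with rarr := Function.update s.rarr a
                    (Function.update (s.rarr a) (idx.val s) (e.val s)) }
  | seq {P Q : Prog} {s s₁ s₂ : State} {t₁ t₂ : ℕ} :
      Exec P s t₁ s₁ → Exec Q s₁ t₂ s₂ → Exec (.seq P Q) s (t₁ + t₂) s₂
  | iteTrue {b : BExp} {P Q : Prog} {s s₁ : State} {t : ℕ} :
      b.holds s → Exec P s t s₁ → Exec (.ite b P Q) s (b.cost + 1 + t) s₁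
  | iteFalse {b : BExp} {P Q : Prog} {s s₁ : State} {t : ℕ} :
      ¬ b.holds s → Exec Q s t s₁ → Exec (.ite b P Q) s (b.cost + 1 + t) s₁
  | whileTrue {b : BExp} {P : Prog} {s s₁ s₂ : State} {t₁ t₂ : ℕ} :
      b.holds s → Exec P s t₁ s₁ → Exec (.while b P) s₁ t₂ s₂ →
      Exec (.while b P) s (b.cost + 1 + t₁ + t₂) s₂
  | whileFalse {b : BExp} {P : Prog} {s : State} :
      ¬ b.holds s → Exec (.while b P) s (b.cost + 1) s

end RealRAM

/-! ### Convex hulls of sets of events -/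

namespace WindowHull

/-- Lexicographic order on points of the plane. -/
def LexLE (a b : ℝ × ℝ) : Prop := a.1 < b.1 ∨ (a.1 = b.1 ∧ a.2 ≤ b.2)

/-- Twice the signed area of the triangle `a b c`; negative iff `a, b, c` turn clockwise. -/
def orient (a b c : ℝ × ℝ) : ℝ :=
  (b.1 - a.1) * (c.2 - a.2) - (b.2 - a.2) * (c.1 - a.1)

/-- The vertices of the convex hull of the points of the events in `S`. -/
def hullVertices (p : ℕ → ℝ × ℝ) (S : Set ℕ) : Set (ℝ × ℝ) :=
  (convexHull ℝ (p '' S)).extremePoints ℝ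

/-- The size of the convex hull. -/
noncomputable def hullSize (p : ℕ → ℝ × ℝ) (S : Set ℕ) : ℕ := (hullVertices p S).ncard

/-- `L` lists the convex hull of the events in `S`: it consists of events of `S` whose points are
the hull vertices, each vertex once, in clockwise order, starting with the lexicographically
largest point. -/
structure IsHullList (p : ℕ → ℝ × ℝ) (S : Set ℕ) (L : List ℕ) : Prop where
  mem : ∀ e ∈ L, e ∈ S
  nodup : (L.map p).Nodup
  vertices : {x | x ∈ L.map p} = hullVertices p S
  first : ∀ e ∈ L.head?, ∀ f ∈ S, LexLE (p f) (p e)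
  clockwise : ∀ (a b c : ℕ) (_ : a < b) (_ : b < c) (hc : c < L.length),
    orient (p L[a]) (p L[b]) (p L[c]) < 0

/-! ### The decomposition tree over time

All leaves of the tree over events `0, …, n - 1` are on level `0`. The `k`-th node on level
`ℓ + 1` is the parent of the nodes `2 * k` and `2 * k + 1` on level `ℓ` (of the first only, if the
second does not exist). The root is node `0` on level `⌈log₂ n⌉`. -/

/-- There is a `k`-th node (counting from `0`) on level `ℓ`. -/
def IsNode (n ℓ k : ℕ) : Prop := ℓ ≤ Nat.clog 2 n ∧ k * 2 ^ ℓ < n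

/-- The canonical subset of the `k`-th node on level `ℓ`: a single event for a leaf, otherwise
the union of the canonical subsets of the children. It is empty if there is no such node. -/
def canonicalSet (n : ℕ) : ℕ → ℕ → Set ℕ
  | 0, k => {t | t = k ∧ t < n}
  | ℓ + 1, k => canonicalSet n ℓ (2 * k) ∪ canonicalSet n ℓ (2 * k + 1)

/-- The integer arrays that hold the tree: the address of the leaf of each event, the links to
parent, children and neighbours on the same level, and the hulls (for each node: where its hull
begins in the array `hullEvent`, how many vertices it has, the position in it of the
lexicographically smallest vertex). -/
abbrev leafArr : ℕ := 0
abbrev parentArr : ℕ := 1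
abbrev leftArr : ℕ := 2
abbrev rightArr : ℕ := 3
abbrev nextArr : ℕ := 4
abbrev prevArr : ℕ := 5
abbrev hullPosArr : ℕ := 6
abbrev hullLenArr : ℕ := 7
abbrev hullMinArr : ℕ := 8
abbrev hullEventArr : ℕ := 9

/-- The integer array that receives the output. -/
abbrev outArr : ℕ := 10

/-- The real arrays that hold the coordinates of the points. -/
abbrev xArr : ℕ := 0
abbrev yArr : ℕ := 1

/-- The memory of `s` holds the points `p 0, …, p (n - 1)` and their decomposition tree, where
`addr ℓ k` is the address of the `k`-th node on level `ℓ`. Links that lead to no node, and all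
other memory, are arbitrary. -/
structure StoresDecomposition (s : RealRAM.State) (n : ℕ) (p : ℕ → ℝ × ℝ)
    (addr : ℕ → ℕ → ℕ) : Prop where
  xcoord : ∀ e < n, s.rarr xArr e = (p e).1
  ycoord : ∀ e < n, s.rarr yArr e = (p e).2
  addr_inj : ∀ ℓ k ℓ' k', IsNode n ℓ k → IsNode n ℓ' k' → addr ℓ k = addr ℓ' k' →
    ℓ = ℓ' ∧ k = k'
  leaf : ∀ e < n, s.iarr leafArr e = addr 0 e
  parent : ∀ ℓ k, IsNode n ℓ k → IsNode n (ℓ + 1) (k / 2) →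
    s.iarr parentArr (addr ℓ k) = addr (ℓ + 1) (k / 2)
  left : ∀ ℓ k, IsNode n (ℓ + 1) k → IsNode n ℓ (2 * k) →
    s.iarr leftArr (addr (ℓ + 1) k) = addr ℓ (2 * k)
  right : ∀ ℓ k, IsNode n (ℓ + 1) k → IsNode n ℓ (2 * k + 1) →
    s.iarr rightArr (addr (ℓ + 1) k) = addr ℓ (2 * k + 1)
  next : ∀ ℓ k, IsNode n ℓ k → IsNode n ℓ (k + 1) →
    s.iarr nextArr (addr ℓ k) = addr ℓ (k + 1)
  prev : ∀ ℓ k, IsNode n ℓ k → IsNode n ℓ (k + 1) →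
    s.iarr prevArr (addr ℓ (k + 1)) = addr ℓ k
  hull : ∀ ℓ k, IsNode n ℓ k → ∃ L : List ℕ,
    IsHullList p (canonicalSet n ℓ k) L ∧
    s.iarr hullLenArr (addr ℓ k) = L.length ∧
    (∀ (m : ℕ) (hm : m < L.length),
      s.iarr hullEventArr (s.iarr hullPosArr (addr ℓ k) + m) = L[m]) ∧
    ∃ hmin : s.iarr hullMinArr (addr ℓ k) < L.length,
      ∀ e ∈ canonicalSet n ℓ k, LexLE (p L[s.iarr hullMinArr (addr ℓ k)]) (p e)

end WindowHull

/-! The algorithm is gift wrapping in which each step is answered by binary searches in precomputed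
hulls. Climbing from the two end leaves to the root side by side cuts the window into at most two
nodes per level plus one, hence O(log w) canonical subsets (`collect_runs`). Their stored hulls
cover the window.

Everything is ordered lexicographically, which treats vertical lines as an infinitesimal shear
would: differences of ordered points lie in a half-open half-plane, where the sign of the cross
product orders directions transitively (`cross_neg_trans`). The march starts at the
lexicographically largest point and goes along the lower hull from right to left. The successor of
`v` is the extreme point to its left in this order of directions, and among collinear ones the
farthest (`IsNext`, `exists_isNext`). A successor is again a lower vertex of the window
(`IsNext.isLower`), hence a lower vertex of every part of the window that contains it, hence an
entry of the lower chain stored at some node.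

This reduces the search at a node to one case. If the node's chain contains the successor, "the
entry lies to the left of `v` and the chain turns clockwise there" holds exactly from the successor
on (`IsNext.search`), so bisection finds it in O(log w) steps. If not, the search may return any
event of the window: `consider` compares candidates exactly, and a wrong one never beats the true
successor. Tangents to the other hulls need not be characterised.

The upper hull is the lower hull of the negated points, so the same program runs a second time with
the sign in real register 0 reversed, starting from the smallest point. Stored lists are clockwise
from the largest vertex, so they descend to the smallest vertex and then ascend (`clockwise_desc`,
`clockwise_asc`). The ascending part stops before it returns to the largest vertex, which is why the
first entry of each list is an additional candidate.

Each extreme point is on the lower or on the upper hull (`isLower_or_of_mem_hullVertices`) and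
conversely, so the two marches glue to the required list (`isHullList_of_lowerPrefix`). Each march
makes at most h steps, each step inspects O(log w) nodes, and each inspection costs O(log w). -/

namespace RealRAM

/-! ### Rules for total correctness with step bounds -/

/-- Started in `s`, the program `P` halts within `T` steps in a state that satisfies `R`. -/
def Runs (P : Prog) (s : State) (T : ℕ) (R : State → Prop) : Prop :=
  ∃ t s', Exec P s t s' ∧ t ≤ T ∧ R s'

theorem Runs.mono {P : Prog} {s : State} {T T' : ℕ} {R R' : State → Prop}
    (h : Runs P s T R) (hT : T ≤ T') (hR : ∀ s', R s' → R' s') : Runs P s T' R' := by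
  obtain ⟨t, s', he, ht, hr⟩ := h
  exact ⟨t, s', he, ht.trans hT, hR _ hr⟩

theorem Runs.seq {P Q : Prog} {s : State} {T₁ T₂ : ℕ} {R₁ R : State → Prop}
    (h₁ : Runs P s T₁ R₁) (h₂ : ∀ s₁, R₁ s₁ → Runs Q s₁ T₂ R) :
    Runs (.seq P Q) s (T₁ + T₂) R := by
  obtain ⟨t₁, s₁, he₁, ht₁, hr₁⟩ := h₁
  obtain ⟨t₂, s₂, he₂, ht₂, hr₂⟩ := h₂ _ hr₁
  exact ⟨_, _, .seq he₁ he₂, by omega, hr₂⟩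

/-- Rule for loops: `I k` is an invariant under which at most `k` iterations remain. -/
theorem Runs.while {b : BExp} {P : Prog} {T : ℕ} {R : State → Prop} (I : ℕ → State → Prop)
    (hstep : ∀ k s, I k s → b.holds s → ∃ k', k = k' + 1 ∧ Runs P s T (I k'))
    (hend : ∀ k s, I k s → ¬ b.holds s → R s) :
    ∀ (k : ℕ) (s : State), I k s → Runs (.while b P) s ((k + 1) * (T + b.cost + 1)) R := by
  intro k
  induction k with
  | zero =>
    intro s hs
    by_cases hb : b.holds s
    · obtain ⟨k', hk, -⟩ := hstep _ _ hs hb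
      omega
    · exact ⟨_, _, .whileFalse hb, by omega, hend _ _ hs hb⟩
  | succ k ih =>
    intro s hs
    by_cases hb : b.holds s
    · obtain ⟨k', hk, t₁, s₁, he₁, ht₁, hi₁⟩ := hstep _ _ hs hb
      obtain rfl : k' = k := by omega
      obtain ⟨t₂, s₂, he₂, ht₂, hr₂⟩ := ih _ hi₁
      refine ⟨_, _, .whileTrue hb he₁ he₂, ?_, hr₂⟩
      rw [Nat.succ_mul]
      omega
    · refine ⟨_, _, .whileFalse hb, ?_, hend _ _ hs hb⟩
      rw [Nat.succ_mul]
      omega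

/-- Weakest precondition of a loop-free program. -/
def Prog.wp : Prog → (State → Prop) → State → Prop
  | .skip, R, s => R s
  | .setI r e, R, s => R { s with ireg := Function.update s.ireg r (e.val s) }
  | .setR r e, R, s => R { s with rreg := Function.update s.rreg r (e.val s) }
  | .storeI a idx e, R, s =>
    R { s with iarr := Function.update s.iarr a (Function.update (s.iarr a) (idx.val s) (e.val s)) }
  | .storeR a idx e, R, s =>
    R { s with rarr := Function.update s.rarr a (Function.update (s.rarr a) (idx.val s) (e.val s)) }
  | .seq P Q, R, s => P.wp (Q.wp R) s
  | .ite b P Q, R, s => (b.holds s → P.wp R s) ∧ (¬ b.holds s → Q.wp R s)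
  | .while _ _, _, _ => False

/-- Bound for the number of steps of a loop-free program. -/
def Prog.cost : Prog → ℕ
  | .skip => 1
  | .setI _ e => e.cost + 1
  | .setR _ e => e.cost + 1
  | .storeI _ idx e => idx.cost + e.cost + 1
  | .storeR _ idx e => idx.cost + e.cost + 1
  | .seq P Q => P.cost + Q.cost
  | .ite b P Q => b.cost + 1 + (P.cost + Q.cost)
  | .while _ _ => 0

/-- Structural induction. Loops have precondition `False`, so counting them as 0 in `Prog.cost` is
harmless; in later bounds the cost of a program with loops stands for its loop-free remainder. -/
theorem Prog.runs_of_wp (P : Prog) :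
    ∀ (s : State) (R : State → Prop), P.wp R s → Runs P s P.cost R := by
  induction P with
  | skip => exact fun s R h => ⟨_, _, .skip s, le_rfl, h⟩
  | setI r e => exact fun s R h => ⟨_, _, .setI r e s, le_rfl, h⟩
  | setR r e => exact fun s R h => ⟨_, _, .setR r e s, le_rfl, h⟩
  | storeI a idx e => exact fun s R h => ⟨_, _, .storeI a idx e s, le_rfl, h⟩
  | storeR a idx e => exact fun s R h => ⟨_, _, .storeR a idx e s, le_rfl, h⟩
  | seq P Q ihP ihQ => exact fun s R h => (ihP s _ h).seq fun s₁ h₁ => ihQ s₁ R h₁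
  | ite b P Q ihP ihQ =>
    intro s R h
    by_cases hb : b.holds s
    · obtain ⟨t, s', he, ht, hr⟩ := ihP s R (h.1 hb)
      exact ⟨_, _, .iteTrue hb he, by simp only [Prog.cost]; omega, hr⟩
    · obtain ⟨t, s', he, ht, hr⟩ := ihQ s R (h.2 hb)
      exact ⟨_, _, .iteFalse hb he, by simp only [Prog.cost]; omega, hr⟩
  | _ b P ih => exact fun s R h => h.elim

/-- `s'` has the same memory as `s`, except possibly for the integer registers from `k` on. -/
structure Keeps (k : ℕ) (s s' : State) : Prop where
  iarr : s'.iarr = s.iarr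
  rarr : s'.rarr = s.rarr
  rreg : s'.rreg = s.rreg
  ireg : ∀ r < k, s'.ireg r = s.ireg r

theorem Keeps.refl (k : ℕ) (s : State) : Keeps k s s := ⟨rfl, rfl, rfl, fun _ _ => rfl⟩

theorem Keeps.trans {k l : ℕ} {s s' s'' : State} (h : Keeps k s s') (h' : Keeps l s' s'')
    (hkl : k ≤ l) : Keeps k s s'' :=
  ⟨h'.iarr.trans h.iarr, h'.rarr.trans h.rarr, h'.rreg.trans h.rreg,
    fun r hr => (h'.ireg r (by omega)).trans (h.ireg r hr)⟩

theorem Keeps.weaken {k l : ℕ} {s s' : State} (h : Keeps l s s') (hkl : k ≤ l) : Keeps k s s' :=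
  (Keeps.refl k s).trans h hkl

end RealRAM

namespace WindowHull

/-! ### Orientations and the lexicographic order -/

theorem toLex_lt_iff {a b : ℝ × ℝ} :
    toLex a < toLex b ↔ a.1 < b.1 ∨ a.1 = b.1 ∧ a.2 < b.2 := Prod.Lex.toLex_lt_toLex

theorem lexLE_iff {a b : ℝ × ℝ} : LexLE a b ↔ toLex a ≤ toLex b :=
  Prod.Lex.toLex_le_toLex.symm

/-- Lexicographically positive vectors. -/
def LexPos (d : ℝ × ℝ) : Prop := 0 < d.1 ∨ d.1 = 0 ∧ 0 < d.2

theorem lexPos_sub {a b : ℝ × ℝ} (h : toLex a < toLex b) : LexPos (b - a) := by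
  rw [toLex_lt_iff] at h
  rcases h with h | ⟨h, h'⟩
  · exact .inl (by simpa using h)
  · exact .inr ⟨by simp [h], by simpa using h'⟩

/-- The cross product of two vectors of the plane. -/
def cross (d e : ℝ × ℝ) : ℝ := d.1 * e.2 - d.2 * e.1

/-- Lexicographically positive vectors have angles in (-π/2, π/2], and there a nonpositive cross
product means that the angle does not increase. Almost all later geometric steps are instances of
this transitivity. -/
theorem cross_neg_trans {d e f : ℝ × ℝ} (hd : LexPos d) (he : LexPos e) (hf : LexPos f)
    (h : cross d e ≤ 0) (h' : cross e f ≤ 0) (hs : cross d e < 0 ∨ cross e f < 0) :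
    cross d f < 0 := by
  unfold LexPos at hd he hf
  unfold cross at *
  have key : e.1 * (d.1 * f.2 - d.2 * f.1) =
      d.1 * (e.1 * f.2 - e.2 * f.1) + f.1 * (d.1 * e.2 - d.2 * e.1) := by ring
  have hd0 : 0 ≤ d.1 := by rcases hd with h | ⟨h, -⟩ <;> linarith
  have hf0 : 0 ≤ f.1 := by rcases hf with h | ⟨h, -⟩ <;> linarith
  rcases he with he | ⟨he, he2⟩
  · by_contra! hc
    have h0 : 0 ≤ e.1 * (d.1 * f.2 - d.2 * f.1) := by positivity
    have h1 := mul_nonpos_of_nonneg_of_nonpos hd0 h'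
    have h2 := mul_nonpos_of_nonneg_of_nonpos hf0 h
    rcases hs with hs | hs
    · have hf1 : f.1 = 0 := by
        rcases hf with hf | hf
        · nlinarith
        · exact hf.1
      have hf2 : 0 < f.2 := by rcases hf with hf | hf <;> [linarith; exact hf.2]
      rw [hf1] at h'
      nlinarith
    · have hd1 : d.1 = 0 := by
        rcases hd with hd | hd
        · nlinarith
        · exact hd.1
      have hd2 : 0 < d.2 := by rcases hd with hd | hd <;> [linarith; exact hd.2]
      have hf1 : f.1 = 0 := by
        rw [hd1] at h
        rcases hf with hf | hf
        · rw [hd1] at hc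
          nlinarith
        · exact hf.1
      have hf2 : 0 < f.2 := by rcases hf with hf | hf <;> [linarith; exact hf.2]
      rw [hf1] at hs
      nlinarith
  -- A vertical `e` has the largest angle of all, so `d` must be vertical too.
  · rw [he] at h h' hs
    have hd1 : d.1 = 0 := by nlinarith
    rw [hd1] at hs hd
    have hd2 : 0 < d.2 := by rcases hd with hd | hd <;> [linarith; exact hd.2]
    have hs' : 0 < f.1 := by
      rcases hs with hs | hs
      · linarith
      · by_contra! hc
        nlinarith
    rw [hd1]
    nlinarith

theorem orient_rotate (a b c : ℝ × ℝ) : orient a b c = orient b c a := by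
  unfold orient; ring

theorem orient_swap (a b c : ℝ × ℝ) : orient a c b = -orient a b c := by
  unfold orient; ring

theorem orient_neg (a b c : ℝ × ℝ) : orient (-a) (-b) (-c) = orient a b c := by
  simp only [orient, Prod.fst_neg, Prod.snd_neg]; ring

theorem orient_eq_cross (a b c : ℝ × ℝ) : orient a b c = cross (a - b) (b - c) := by
  simp only [orient, cross, Prod.fst_sub, Prod.snd_sub]; ring

theorem toLex_neg_lt {a b : ℝ × ℝ} : toLex (-a) < toLex (-b) ↔ toLex b < toLex a := by
  simp only [toLex_lt_iff, Prod.fst_neg, Prod.snd_neg, neg_lt_neg_iff, neg_inj]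
  rw [eq_comm]

/-! ### Lower hulls and the gift wrapping step -/

/-- `v` is a vertex of the lower hull of the points of the events in `S`. -/
def IsLower (Q : ℕ → ℝ × ℝ) (S : Set ℕ) (v : ℝ × ℝ) : Prop :=
  ∀ x ∈ S, ∀ y ∈ S, toLex (Q y) < toLex v → toLex v < toLex (Q x) → orient (Q x) v (Q y) < 0

theorem IsLower.mono {Q : ℕ → ℝ × ℝ} {S S' : Set ℕ} {v : ℝ × ℝ} (h : IsLower Q S v)
    (hS : S' ⊆ S) : IsLower Q S' v := fun x hx y hy => h x (hS hx) y (hS hy)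

/-- The event `u` follows the event `v` on the lower hull traversed from right to left. -/
structure IsNext (Q : ℕ → ℝ × ℝ) (S : Set ℕ) (v u : ℕ) : Prop where
  mem : u ∈ S
  lt : toLex (Q u) < toLex (Q v)
  dom : ∀ x ∈ S, toLex (Q x) < toLex (Q v) →
    orient (Q v) (Q u) (Q x) < 0 ∨ orient (Q v) (Q u) (Q x) = 0 ∧ toLex (Q u) ≤ toLex (Q x)

theorem IsNext.orient_nonpos {Q : ℕ → ℝ × ℝ} {S : Set ℕ} {v u x : ℕ} (h : IsNext Q S v u)
    (hx : x ∈ S) (hv : toLex (Q x) < toLex (Q v)) : orient (Q v) (Q u) (Q x) ≤ 0 := by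
  rcases h.dom x hx hv with h | h
  · exact h.le
  · exact h.1.le

theorem IsNext.orient_neg_of_lt {Q : ℕ → ℝ × ℝ} {S : Set ℕ} {v u x : ℕ} (h : IsNext Q S v u)
    (hx : x ∈ S) (hv : toLex (Q x) < toLex (Q u)) : orient (Q v) (Q u) (Q x) < 0 := by
  rcases h.dom x hx (hv.trans h.lt) with h | h
  · exact h
  · exact absurd hv h.2.not_gt

/-- Comparison of events by the direction in which they are seen from `v`. -/
def Dom (Q : ℕ → ℝ × ℝ) (v u x : ℕ) : Prop :=
  orient (Q v) (Q u) (Q x) < 0 ∨ orient (Q v) (Q u) (Q x) = 0 ∧ toLex (Q u) ≤ toLex (Q x)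

theorem Dom.total (Q : ℕ → ℝ × ℝ) (v u x : ℕ) : Dom Q v u x ∨ Dom Q v x u := by
  unfold Dom
  rw [orient_swap (Q v) (Q u) (Q x)]
  rcases lt_trichotomy (orient (Q v) (Q u) (Q x)) 0 with h | h | h
  · exact .inl (.inl h)
  · rcases le_total (toLex (Q u)) (toLex (Q x)) with h' | h'
    · exact .inl (.inr ⟨h, h'⟩)
    · exact .inr (.inr ⟨by linarith, h'⟩)
  · exact .inr (.inl (by linarith))

theorem cross_nonpos_trans {d e f : ℝ × ℝ} (hd : LexPos d) (he : LexPos e) (hf : LexPos f)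
    (h : cross d e ≤ 0) (h' : cross e f ≤ 0) : cross d f ≤ 0 := by
  by_contra! hc
  have h1 : cross f d < 0 := by unfold cross at *; linarith
  have h2 := cross_neg_trans he hf hd h' h1.le (.inr h1)
  have h3 : cross e d = -cross d e := by unfold cross; ring
  linarith

theorem orient_eq_cross_left (v u x : ℝ × ℝ) : orient v u x = cross (v - u) (v - x) := by
  simp only [orient, cross, Prod.fst_sub, Prod.snd_sub]; ring

theorem Dom.trans {Q : ℕ → ℝ × ℝ} {v a b c : ℕ} (ha : toLex (Q a) < toLex (Q v))
    (hb : toLex (Q b) < toLex (Q v)) (hc : toLex (Q c) < toLex (Q v))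
    (h : Dom Q v a b) (h' : Dom Q v b c) : Dom Q v a c := by
  unfold Dom at *
  rw [orient_eq_cross_left] at *
  have ha := lexPos_sub ha
  have hb := lexPos_sub hb
  have hc := lexPos_sub hc
  rcases h with h | ⟨h, h1⟩
  · rcases h' with h' | ⟨h', h1'⟩
    · exact .inl (cross_neg_trans ha hb hc h.le h'.le (.inl h))
    · exact .inl (cross_neg_trans ha hb hc h.le h'.le (.inl h))
  · rcases h' with h' | ⟨h', h1'⟩
    · exact .inl (cross_neg_trans ha hb hc h.le h'.le (.inr h'))
    · rcases (cross_nonpos_trans ha hb hc h.le h'.le).lt_or_eq with h2 | h2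
      · exact .inl h2
      · exact .inr ⟨h2, h1.trans h1'⟩

/-- On the events to the left of `v`, `Dom` is a total preorder, so a nonempty finite set of them
has a first element. -/
theorem exists_isNext {Q : ℕ → ℝ × ℝ} {S : Set ℕ} (hS : S.Finite) {v y : ℕ} (hy : y ∈ S)
    (hyv : toLex (Q y) < toLex (Q v)) : ∃ u, IsNext Q S v u := by
  have main : ∀ F : Finset ℕ, (∀ x ∈ F, toLex (Q x) < toLex (Q v)) → F.Nonempty →
      ∃ u ∈ F, ∀ x ∈ F, Dom Q v u x := by
    intro F
    induction F using Finset.induction_on with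
    | empty => simp
    | insert a F ha ih =>
      intro hF _
      have haa : Dom Q v a a := by simpa using Dom.total Q v a a
      by_cases hne : F.Nonempty
      · obtain ⟨u, hu, hd⟩ := ih (fun x hx => hF x (Finset.mem_insert_of_mem hx)) hne
        have hu' : u ∈ insert a F := Finset.mem_insert_of_mem hu
        rcases Dom.total Q v u a with h | h
        · refine ⟨u, hu', fun x hx => ?_⟩
          rcases Finset.mem_insert.1 hx with rfl | hx
          exacts [h, hd x hx]
        · refine ⟨a, Finset.mem_insert_self _ _, fun x hx => ?_⟩
          rcases Finset.mem_insert.1 hx with rfl | hx'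
          · exact haa
          · exact h.trans (hF a (Finset.mem_insert_self _ _)) (hF u hu') (hF x hx) (hd x hx')
      · rw [Finset.not_nonempty_iff_eq_empty] at hne
        subst hne
        exact ⟨a, by simp, by simpa using haa⟩
  have hfin : {x ∈ S | toLex (Q x) < toLex (Q v)}.Finite := hS.subset fun x hx => hx.1
  obtain ⟨u, hu, hd⟩ := main hfin.toFinset (by simp) ⟨y, by simp [hy, hyv]⟩
  simp only [Set.Finite.mem_toFinset, Set.mem_ofPred_eq] at hu hd
  exact ⟨u, hu.1, hu.2, fun x hx hxv => hd x ⟨hx, hxv⟩⟩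

/-- For `x` to the right of `u` and `y` to the left, the directions `x - u`, `v - u`, `u - y` turn
clockwise, the last turn being strict because ties were broken in favour of the farthest point. The
first turn comes from the choice of `u` if `x` is to the left of `v`, and from `v` being a lower
vertex if `x` is to the right. -/
theorem IsNext.isLower {Q : ℕ → ℝ × ℝ} {S : Set ℕ} {v u : ℕ} (h : IsNext Q S v u)
    (hv : IsLower Q S (Q v)) : IsLower Q S (Q u) := by
  intro x hx y hy hyu hux
  have h1 := h.orient_neg_of_lt hy hyu
  have hu := lexPos_sub h.lt
  rw [orient_eq_cross] at h1 ⊢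
  refine cross_neg_trans (lexPos_sub hux) hu (lexPos_sub hyu) ?_ h1.le (.inr h1)
  rcases lt_trichotomy (toLex (Q x)) (toLex (Q v)) with hxv | hxv | hxv
  · have h2 := h.orient_nonpos hx hxv
    have : orient (Q v) (Q u) (Q x) = cross (Q x - Q u) (Q v - Q u) := by
      simp only [orient, cross, Prod.fst_sub, Prod.snd_sub]; ring
    linarith
  · rw [toLex.injective hxv]
    unfold cross
    linarith
  · have h2 := hv x hx u h.mem h.lt hxv
    have : orient (Q x) (Q v) (Q u) = cross (Q x - Q u) (Q v - Q u) := by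
      simp only [orient, cross, Prod.fst_sub, Prod.snd_sub]; ring
    linarith

/-! ### Convex chains and the search predicate -/

/-- `c lo, …, c hi` are the events of a convex chain, from right to left. -/
structure IsChain (Q : ℕ → ℝ × ℝ) (S : Set ℕ) (c : ℕ → ℕ) (lo hi : ℕ) : Prop where
  le : lo ≤ hi
  mem : ∀ a, lo ≤ a → a ≤ hi → c a ∈ S
  lt : ∀ a b, lo ≤ a → a < b → b ≤ hi → toLex (Q (c b)) < toLex (Q (c a))
  convex : ∀ a b d, lo ≤ a → a < b → b < d → d ≤ hi → orient (Q (c a)) (Q (c b)) (Q (c d)) < 0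

/-- The search predicate on convex chains is monotone if the chain contains the sought event. -/
theorem IsNext.search {Q : ℕ → ℝ × ℝ} {S : Set ℕ} {v u : ℕ} (h : IsNext Q S v u)
    {c : ℕ → ℕ} {lo hi q₀ : ℕ} (hc : IsChain Q S c lo hi) (hlo : lo ≤ q₀) (hhi : q₀ ≤ hi)
    (hu : Q (c q₀) = Q u) {q : ℕ} (hq : lo ≤ q) (hq' : q < hi) :
    (toLex (Q (c q)) < toLex (Q v) ∧ orient (Q v) (Q (c q)) (Q (c (q + 1))) < 0) ↔ q₀ ≤ q := by
  have hq1 := hc.lt q (q + 1) hq (by omega) (by omega)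
  have hmq1 := hc.mem (q + 1) (by omega) (by omega)
  constructor
  · rintro ⟨hlt, ho⟩
    by_contra! hqq
    have h1 := h.orient_nonpos (hc.mem q hq hq'.le) hlt
    rcases Nat.lt_or_ge (q + 1) q₀ with hlt' | hge
    · have h2 := hc.convex q (q + 1) q₀ hq (by omega) hlt' hhi
      have h3 := hc.lt (q + 1) q₀ (by omega) hlt' hhi
      rw [hu] at h2 h3
      rw [orient_eq_cross] at ho h2
      -- A clockwise turn at `c q` seen from `v`, continued along the chain, would put `u` strictly
      -- beyond `c q`, against the choice of `u`.
      have h4 := cross_neg_trans (lexPos_sub hlt) (lexPos_sub hq1) (lexPos_sub h3) ho.le h2.le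
        (.inl ho)
      simp only [orient, cross, Prod.fst_sub, Prod.snd_sub] at *
      linarith
    · obtain rfl : q₀ = q + 1 := by omega
      rw [hu, orient_swap] at ho
      linarith
  · intro hqq
    rcases hqq.lt_or_eq with hlt | rfl
    · have h1 := hc.lt q₀ q hlo hlt hq'.le
      have h2 := hc.convex q₀ q (q + 1) hlo hlt (by omega) (by omega)
      rw [hu] at h1 h2
      have h3 := h.orient_neg_of_lt (hc.mem q hq hq'.le) h1
      refine ⟨h1.trans h.lt, ?_⟩
      rw [orient_eq_cross] at h2 h3
      have h4 := cross_neg_trans (lexPos_sub h.lt) (lexPos_sub h1) (lexPos_sub hq1) h3.le h2.le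
        (.inl h3)
      simp only [orient, cross, Prod.fst_sub, Prod.snd_sub] at *
      linarith
    · rw [hu] at hq1 ⊢
      exact ⟨h.lt, h.orient_neg_of_lt hmq1 hq1⟩

/-! ### The vertices of a convex hull -/

/-- In a convex polygon traversed clockwise from its lexicographically largest vertex, the
vertices up to the smallest one descend. -/
theorem clockwise_desc {f : ℕ → ℝ × ℝ} {len μ : ℕ} (hμ : μ < len)
    (hinj : ∀ a b, a < b → b < len → f a ≠ f b)
    (hmax : ∀ a < len, toLex (f a) ≤ toLex (f 0)) (hmin : ∀ a < len, toLex (f μ) ≤ toLex (f a))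
    (hcw : ∀ a b c, a < b → b < c → c < len → orient (f a) (f b) (f c) < 0)
    {a b : ℕ} (hab : a < b) (hb : b ≤ μ) : toLex (f b) < toLex (f a) := by
  have hlt : ∀ {a b : ℕ}, a < b → b < len → toLex (f b) ≤ toLex (f a) →
      toLex (f b) < toLex (f a) := fun h h' h'' =>
    h''.lt_of_ne fun he => hinj _ _ h h' (toLex.injective he).symm
  rcases Nat.eq_zero_or_pos a with rfl | ha
  · exact hlt hab (by omega) (hmax _ (by omega))
  rcases hb.eq_or_lt with rfl | hb
  · exact hlt hab (by omega) (hmin _ (by omega))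
  refine hlt hab (by omega) ?_
  -- If `f a` were smaller than `f b`, the triples containing `μ` would make the directions `f 0 - f
  -- a`, `f a - f μ`, `f b - f a` turn clockwise in this order, while the triple `0, a, b` says that
  -- the third is counterclockwise of the first.
  by_contra! h
  have h1 := lexPos_sub (hlt (hab.trans hb) hμ (hmin a (by omega)))
  have h2 := lexPos_sub (hlt ha (by omega) (hmax a (by omega)))
  have h3 := lexPos_sub h
  have c1 := hcw 0 a b ha hab (by omega)
  have c2 := hcw 0 a μ ha (by omega) hμ
  have c3 := hcw a b μ hab hb hμ
  have c4 := cross_neg_trans h2 h1 h3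
  simp only [orient, cross, Prod.fst_sub, Prod.snd_sub] at *
  have := c4 (by linarith) (by linarith) (.inl (by linarith))
  linarith

/-- The counterpart for the rest of the polygon: a descent from `a` to `b` after `μ` would
contradict the three triples formed by `0`, `μ`, `a`, `b` that contain `a`. -/
theorem clockwise_asc {f : ℕ → ℝ × ℝ} {len μ : ℕ} (hμ : μ < len)
    (hinj : ∀ a b, a < b → b < len → f a ≠ f b)
    (hmax : ∀ a < len, toLex (f a) ≤ toLex (f 0)) (hmin : ∀ a < len, toLex (f μ) ≤ toLex (f a))
    (hcw : ∀ a b c, a < b → b < c → c < len → orient (f a) (f b) (f c) < 0)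
    {a b : ℕ} (ha : μ ≤ a) (hab : a < b) (hb : b < len) : toLex (f a) < toLex (f b) := by
  have hlt : ∀ {a b : ℕ}, a < b → b < len → toLex (f a) ≤ toLex (f b) →
      toLex (f a) < toLex (f b) := fun h h' h'' =>
    h''.lt_of_ne fun he => hinj _ _ h h' (toLex.injective he)
  rcases ha.eq_or_lt with rfl | ha
  · exact hlt hab hb (hmin _ hb)
  have hμ0 : 0 < μ := by
    rcases Nat.eq_zero_or_pos μ with rfl | h
    · exact absurd (toLex.injective (le_antisymm (hmin a (by omega)) (hmax a (by omega))))
        (hinj 0 a ha (by omega))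
    · exact h
  refine hlt hab hb ?_
  by_contra! h
  have h1 := lexPos_sub (hlt (ha.trans hab) hb (hmin b hb) |>.trans h)
  have h2 := lexPos_sub ((hmax a (by omega)).lt_of_ne fun he =>
    hinj 0 a (by omega) (by omega) (toLex.injective he).symm)
  have h3 := lexPos_sub h
  have c1 := hcw 0 a b (by omega) hab hb
  have c2 := hcw 0 μ a hμ0 ha (by omega)
  have c3 := hcw μ a b ha hab hb
  have c4 := cross_neg_trans h2 h3 h1
  simp only [orient, cross, Prod.fst_sub, Prod.snd_sub] at *
  have := c4 (by linarith) (by linarith) (.inl (by linarith))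
  linarith

theorem hullVertices_neg (p : ℕ → ℝ × ℝ) (S : Set ℕ) :
    hullVertices (fun e => -p e) S = -hullVertices p S := by
  have h1 : (fun e => -p e) '' S = -(p '' S) := by
    rw [← Set.image_neg_eq_neg, Set.image_image]
  unfold hullVertices
  rw [h1, convexHull_neg, ← Set.image_neg_eq_neg, ← Set.image_neg_eq_neg]
  exact (image_extremePoints (LinearEquiv.neg ℝ : (ℝ × ℝ) ≃ₗ[ℝ] ℝ × ℝ) _).symm

theorem hullVertices_subset {p : ℕ → ℝ × ℝ} {S : Set ℕ} {z : ℝ × ℝ}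
    (h : z ∈ hullVertices p S) : ∃ e ∈ S, p e = z := by
  simpa using extremePoints_convexHull_subset h

/-- Points on one side of a line, or on a ray of the line, form a convex set. -/
theorem convex_halfPlane_ray (d v : ℝ × ℝ) :
    Convex ℝ {z : ℝ × ℝ | cross d (z - v) < 0 ∨
      cross d (z - v) = 0 ∧ 0 ≤ d.1 * (z - v).1 + d.2 * (z - v).2} := by
  rw [convex_iff_forall_pos]
  rintro x hx y hy s t hs ht hst
  simp only [Set.mem_ofPred_eq] at *
  have e0 : s • x + t • y - v = s • (x - v) + t • (y - v) := by
    rw [smul_sub, smul_sub]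
    nth_rewrite 1 [← one_smul ℝ v]
    rw [← hst, add_smul]
    abel
  have e1 : cross d (s • x + t • y - v) = s * cross d (x - v) + t * cross d (y - v) := by
    rw [e0]
    simp only [cross, Prod.fst_add, Prod.snd_add, Prod.smul_fst, Prod.smul_snd, smul_eq_mul]
    ring
  have e2 : d.1 * (s • x + t • y - v).1 + d.2 * (s • x + t • y - v).2 =
      s * (d.1 * (x - v).1 + d.2 * (x - v).2) + t * (d.1 * (y - v).1 + d.2 * (y - v).2) := by
    rw [e0]
    simp only [Prod.fst_add, Prod.snd_add, Prod.smul_fst, Prod.smul_snd, smul_eq_mul]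
    ring
  rw [e1, e2]
  rcases hx with hx | ⟨hx, hx'⟩
  · have h1 := mul_neg_of_pos_of_neg hs hx
    have h2 : t * cross d (y - v) ≤ 0 := by
      rcases hy with hy | ⟨hy, -⟩
      · exact (mul_neg_of_pos_of_neg ht hy).le
      · rw [hy, mul_zero]
    exact .inl (by linarith)
  · rw [hx]
    rcases hy with hy | ⟨hy, hy'⟩
    · have h2 := mul_neg_of_pos_of_neg ht hy
      exact .inl (by linarith)
    · rw [hy]
      exact .inr ⟨by ring, by positivity⟩

/-- An open half-plane together with a closed ray on its boundary has the endpoint of the ray as an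
extreme point. If such a set with endpoint `p e` contains all points, it contains their hull, so `p
e` is extreme there as well. Allowing the ray is what admits further points on a supporting line. -/
theorem mem_hullVertices_of_dir {p : ℕ → ℝ × ℝ} {S : Set ℕ} {e : ℕ} (he : e ∈ S) {d : ℝ × ℝ}
    (hd : d.1 ≠ 0 ∨ d.2 ≠ 0)
    (h : ∀ x ∈ S, cross d (p x - p e) < 0 ∨
      cross d (p x - p e) = 0 ∧ 0 ≤ d.1 * (p x - p e).1 + d.2 * (p x - p e).2) :
    p e ∈ hullVertices p S := by
  have hsub := convexHull_min (s := p '' S) (by rintro _ ⟨x, hx, rfl⟩; exact h x hx)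
    (convex_halfPlane_ray d (p e))
  refine mem_extremePoints_iff_left.2 ⟨subset_convexHull ℝ _ ⟨e, he, rfl⟩, ?_⟩
  rintro x hx y hy ⟨s, t, hs, ht, hst, hxy⟩
  have hx := hsub hx
  have hy := hsub hy
  simp only [Set.mem_ofPred_eq] at hx hy
  have f1 : s * (x - p e).1 + t * (y - p e).1 = 0 := by
    have : s * x.1 + t * y.1 = (p e).1 := by rw [← hxy]; simp
    simp only [Prod.fst_sub]
    linear_combination this - (p e).1 * hst
  have f2 : s * (x - p e).2 + t * (y - p e).2 = 0 := by
    have : s * x.2 + t * y.2 = (p e).2 := by rw [← hxy]; simp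
    simp only [Prod.snd_sub]
    linear_combination this - (p e).2 * hst
  have g1 : s * cross d (x - p e) + t * cross d (y - p e) = 0 := by
    unfold cross
    linear_combination d.1 * f2 - d.2 * f1
  have g2 : s * (d.1 * (x - p e).1 + d.2 * (x - p e).2) +
      t * (d.1 * (y - p e).1 + d.2 * (y - p e).2) = 0 := by
    linear_combination d.1 * f1 + d.2 * f2
  have hy0 : cross d (y - p e) ≤ 0 := by
    rcases hy with hy | hy
    exacts [hy.le, hy.1.le]
  rcases hx with hx | ⟨hx, hx'⟩
  · nlinarith
  rcases hy with hy | ⟨hy, hy'⟩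
  · nlinarith
  have hx2 : d.1 * (x - p e).1 + d.2 * (x - p e).2 = 0 := by
    refine le_antisymm ?_ hx'
    by_contra! hc
    have := mul_pos hs hc
    have := mul_nonneg ht.le hy'
    linarith
  unfold cross at hx
  have hdd : d.1 * d.1 + d.2 * d.2 ≠ 0 := by
    intro h0
    have h1 : d.1 = 0 := by nlinarith [mul_self_nonneg d.1, mul_self_nonneg d.2]
    have h2 : d.2 = 0 := by nlinarith [mul_self_nonneg d.1, mul_self_nonneg d.2]
    exact hd.elim (· h1) (· h2)
  refine sub_eq_zero.1 (Prod.ext ?_ ?_)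
  · exact (mul_eq_zero_iff_left hdd).1 (by linear_combination d.1 * hx2 - d.2 * hx)
  · exact (mul_eq_zero_iff_left hdd).1 (by linear_combination d.2 * hx2 + d.1 * hx)

/-- The supporting line goes through `v` and its successor. If `v` has none, it is the smallest
point and the line is vertical. -/
theorem IsLower.mem_hullVertices {Q : ℕ → ℝ × ℝ} {S : Set ℕ} (hS : S.Finite) {v : ℕ}
    (hvS : v ∈ S) (hv : IsLower Q S (Q v)) : Q v ∈ hullVertices Q S := by
  by_cases hy : ∃ y ∈ S, toLex (Q y) < toLex (Q v)
  · obtain ⟨y, hy, hyv⟩ := hy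
    obtain ⟨u, hu⟩ := exists_isNext hS hy hyv
    have hd := lexPos_sub hu.lt
    refine mem_hullVertices_of_dir hvS (d := Q u - Q v) ?_ fun x hx => ?_
    · simp only [Prod.fst_sub, Prod.snd_sub]
      by_contra! hc
      exact hu.lt.ne (congrArg toLex (Prod.ext (sub_eq_zero.1 hc.1) (sub_eq_zero.1 hc.2)))
    have ho : orient (Q v) (Q u) (Q x) = cross (Q u - Q v) (Q x - Q v) := rfl
    rw [← ho]
    rcases lt_trichotomy (toLex (Q x)) (toLex (Q v)) with hxv | hxv | hxv
    · rcases hu.dom x hx hxv with h | ⟨h, -⟩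
      · exact .inl h
      refine .inr ⟨h, ?_⟩
      have hd' := lexPos_sub hxv
      unfold LexPos at hd hd'
      simp only [orient, Prod.fst_sub, Prod.snd_sub] at *
      rcases hd with hd | ⟨hd, hd2⟩
      · rcases hd' with hd' | ⟨hd', hd2'⟩
        · have h1 := mul_pos hd hd'
          by_contra! hc
          -- By collinearity the scalar product of `Q u - Q v` and `Q x - Q v` is a multiple of the
          -- squared length of `Q u - Q v`, with the ratio of two negative first coordinates as
          -- factor.
          have h3 : ((Q u).1 - (Q v).1) * (((Q u).1 - (Q v).1) * ((Q x).1 - (Q v).1) +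
            ((Q u).2 - (Q v).2) * ((Q x).2 - (Q v).2)) =
            ((Q x).1 - (Q v).1) * (((Q u).1 - (Q v).1) ^ 2 + ((Q u).2 - (Q v).2) ^ 2) := by
            linear_combination ((Q u).2 - (Q v).2) * h
          nlinarith [sq_nonneg ((Q u).2 - (Q v).2), sq_nonneg ((Q u).1 - (Q v).1)]
        · have h1 := mul_pos hd hd2'
          rw [show (Q x).1 - (Q v).1 = 0 by linarith] at h
          linarith
      · rcases hd' with hd' | ⟨hd', hd2'⟩
        · have h1 := mul_pos hd2 hd'
          rw [show (Q u).1 - (Q v).1 = 0 by linarith] at h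
          linarith
        · nlinarith
    · rw [toLex.injective hxv]
      exact .inr ⟨by unfold orient; ring, by simp⟩
    · left
      have := hv x hx u hu.mem hu.lt hxv
      rwa [orient_rotate] at this
  · push Not at hy
    refine mem_hullVertices_of_dir hvS (d := (0, 1)) (by simp) fun x hx => ?_
    have := hy x hx
    rw [Prod.Lex.toLex_le_toLex] at this
    simpa [cross, sub_eq_zero, eq_comm] using this

theorem mem_of_orient_eq_zero {x v y : ℝ × ℝ} {C : Set (ℝ × ℝ)} (hC : Convex ℝ C) (hxC : x ∈ C)
    (hyC : y ∈ C) (hy : toLex y < toLex v) (hx : toLex v < toLex x)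
    (h : orient x v y = 0) : v ∈ C := by
  have hd := lexPos_sub hx
  have he := lexPos_sub hy
  unfold LexPos at hd he
  simp only [Prod.fst_sub, Prod.snd_sub] at hd he
  unfold orient at h
  have key : ∀ s t : ℝ, 0 ≤ s → 0 ≤ t → 0 < s + t → s * (x.1 - v.1) = t * (v.1 - y.1) →
      s * (x.2 - v.2) = t * (v.2 - y.2) → v ∈ C := by
    intro s t hs ht hst h1 h2
    have := convex_iff_div.1 hC hxC hyC hs ht hst
    convert this using 1
    ext
    · simp only [Prod.fst_add, Prod.smul_fst, smul_eq_mul]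
      field_simp
      linarith
    · simp only [Prod.snd_add, Prod.smul_snd, smul_eq_mul]
      field_simp
      linarith
  have hd1 : 0 ≤ x.1 - v.1 := by rcases hd with h | ⟨h, -⟩ <;> linarith
  have he1 : 0 ≤ v.1 - y.1 := by rcases he with h | ⟨h, -⟩ <;> linarith
  rcases (add_nonneg hd1 he1).lt_or_eq with h0 | h0
  · exact key (v.1 - y.1) (x.1 - v.1) he1 hd1 (by linarith) (by ring) (by linarith)
  · have h1 : x.1 - v.1 = 0 := by linarith
    have h2 : v.1 - y.1 = 0 := by linarith
    rw [h1] at hd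
    rw [h2] at he
    simp only [lt_irrefl, false_or, true_and] at hd he
    exact key (v.2 - y.2) (x.2 - v.2) he.le hd.le (by linarith) (by rw [h1, h2]; ring) (by ring)

/-- The line from `y` through `v` separates `x` from `x'`, and both are on the far side of `v`, so
`v` lies in the triangle `x' x y`. Its barycentric coordinates are the ratios of the areas of the
subtriangles at `v`. -/
theorem mem_of_orient {x x' v y : ℝ × ℝ} {C : Set (ℝ × ℝ)} (hC : Convex ℝ C) (hxC : x ∈ C)
    (hxC' : x' ∈ C) (hyC : y ∈ C) (hy : toLex y < toLex v)
    (hx : toLex v < toLex x) (hx' : toLex v < toLex x')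
    (h : 0 ≤ orient x v y) (h' : orient x' v y ≤ 0) : v ∈ C := by
  rcases h.eq_or_lt with h0 | h
  · exact mem_of_orient_eq_zero hC hxC hyC hy hx h0.symm
  rcases h'.eq_or_lt with h0 | h'
  · exact mem_of_orient_eq_zero hC hxC' hyC hy hx' h0
  have hxx : 0 ≤ -orient v x' x := by
    by_contra! hc
    have e1 : orient v x' x = cross (x' - v) (x - v) := rfl
    have e2 : orient x v y = -cross (v - y) (x - v) := by
      simp only [orient, cross, Prod.fst_sub, Prod.snd_sub]; ring
    have e3 : orient x' v y = cross (x' - v) (v - y) := by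
      simp only [orient, cross, Prod.fst_sub, Prod.snd_sub]; ring
    have := cross_neg_trans (lexPos_sub hx') (lexPos_sub hy) (lexPos_sub hx) (by linarith)
      (by linarith) (.inl (by linarith))
    linarith
  have hpos : 0 < orient x v y + -orient x' v y + -orient v x' x := by linarith
  have h1 := hC.sum_mem (t := Finset.univ)
    (w := ![orient x v y / (orient x v y + -orient x' v y + -orient v x' x),
      -orient x' v y / (orient x v y + -orient x' v y + -orient v x' x),
      -orient v x' x / (orient x v y + -orient x' v y + -orient v x' x)]) (z := ![x', x, y])
    (by
      intro i _
      fin_cases i <;> simp <;> apply div_nonneg <;> linarith)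
    (by
      simp only [Fin.sum_univ_three, Matrix.cons_val_zero, Matrix.cons_val_one, Matrix.cons_val]
      field_simp)
    (by intro i _; fin_cases i <;> simpa)
  convert h1 using 1
  simp only [Fin.sum_univ_three, Matrix.cons_val_zero, Matrix.cons_val_one, Matrix.cons_val]
  ext
  · simp only [Prod.fst_add, Prod.smul_fst, smul_eq_mul]
    field_simp
    unfold orient
    ring
  · simp only [Prod.snd_add, Prod.smul_snd, smul_eq_mul]
    field_simp
    unfold orient
    ring

/-- A vertex of the convex hull lies on the lower or on the upper hull. -/
theorem isLower_or_of_mem_hullVertices {p : ℕ → ℝ × ℝ} {S : Set ℕ} {z : ℝ × ℝ}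
    (h : z ∈ hullVertices p S) : IsLower p S z ∨ IsLower (fun e => -p e) S (-z) := by
  by_contra! hc
  obtain ⟨hl, hu⟩ := hc
  unfold IsLower at hl hu
  push Not at hl hu
  obtain ⟨x, hx, y, hy, hyz, hzx, ho⟩ := hl
  obtain ⟨y', hy', x', hx', hzx', hyz', ho'⟩ := hu
  rw [toLex_neg_lt] at hyz' hzx'
  rw [orient_neg] at ho'
  have ho' : orient (p x') z (p y') ≤ 0 := by
    have : orient (p y') z (p x') = -orient (p x') z (p y') := by unfold orient; ring
    linarith
  have hC := ((convex_convexHull ℝ (p '' S)).mem_extremePoints_iff_convex_sdiff.1 h).2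
  have hmem : ∀ e ∈ S, toLex (p e) ≠ toLex z → p e ∈ convexHull ℝ (p '' S) \ {z} :=
    fun e he hne => ⟨subset_convexHull ℝ _ ⟨e, he, rfl⟩, fun h => hne (congrArg toLex h)⟩
  have hxm := hmem x hx hzx.ne'
  have hym := hmem y hy hyz.ne
  have hxm' := hmem x' hx' hzx'.ne'
  have hym' := hmem y' hy' hyz'.ne
  have : z ∈ convexHull ℝ (p '' S) \ {z} := by
    -- One pair of points has `z` weakly on its upper side, the other weakly on its lower side.
    -- According to the mixed pair `x', y`, the point `z` lies in the triangle `x x' y` or in `y y'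
    -- x'`. Both are within the hull without `z`, which is convex because `z` is extreme.
    rcases le_total (orient (p x') z (p y)) 0 with hm | hm
    · exact mem_of_orient hC hxm hxm' hym hyz hzx hzx' ho hm
    · have hneg : ∀ {a b : ℝ × ℝ}, toLex a < toLex b → toLex (-b) < toLex (-a) :=
        fun h => toLex_neg_lt.2 h
      have hflip : ∀ b, orient (-p b) (-z) (-p x') = -orient (p x') z (p b) := fun b => by
        rw [orient_neg]
        unfold orient
        ring
      have := mem_of_orient (v := -z) hC.neg (Set.neg_mem_neg.2 hym') (Set.neg_mem_neg.2 hym)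
        (Set.neg_mem_neg.2 hxm') (hneg hzx') (hneg hyz') (hneg hyz)
        (by rw [hflip]; linarith) (by rw [hflip]; linarith)
      exact Set.neg_mem_neg.1 this
  exact this.2 rfl

theorem mem_hullVertices_of_isLower_neg {p : ℕ → ℝ × ℝ} {S : Set ℕ} (hS : S.Finite) {v : ℕ}
    (hvS : v ∈ S) (hv : IsLower (fun e => -p e) S (-p v)) : p v ∈ hullVertices p S := by
  have h := IsLower.mem_hullVertices (Q := fun e => -p e) hS hvS hv
  rw [hullVertices_neg] at h
  exact Set.neg_mem_neg.1 h

/-! ### The two chains of a stored hull -/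

section StoredHull

variable {p : ℕ → ℝ × ℝ} {S : Set ℕ} {L : List ℕ} {E : ℕ → ℕ} {pos μ : ℕ}

theorem IsHullList.inj (hL : IsHullList p S L)
    (hE : ∀ (m : ℕ) (hm : m < L.length), E (pos + m) = L[m]) (a b : ℕ) (hab : a < b)
    (hb : b < L.length) : p (E (pos + a)) ≠ p (E (pos + b)) := by
  rw [hE a (hab.trans hb), hE b hb]
  intro h
  have := (List.Nodup.getElem_inj_iff hL.nodup (i := a) (j := b)
    (hi := by simpa using hab.trans hb) (hj := by simpa using hb)).1 (by simpa using h)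
  omega

theorem IsHullList.stored_mem (hL : IsHullList p S L)
    (hE : ∀ (m : ℕ) (hm : m < L.length), E (pos + m) = L[m]) {a : ℕ} (ha : a < L.length) :
    E (pos + a) ∈ S := by
  rw [hE a ha]
  exact hL.mem _ (List.getElem_mem _)

theorem IsHullList.stored_zero (hL : IsHullList p S L)
    (hE : ∀ (m : ℕ) (hm : m < L.length), E (pos + m) = L[m]) (hμ : μ < L.length) {e : ℕ}
    (he : e ∈ S) : toLex (p e) ≤ toLex (p (E (pos + 0))) := by
  rw [hE 0 (by omega), ← lexLE_iff]
  refine hL.first _ ?_ e he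
  simp [List.head?_eq_getElem?, show 0 < L.length by omega]

theorem IsHullList.stored_clockwise (hL : IsHullList p S L)
    (hE : ∀ (m : ℕ) (hm : m < L.length), E (pos + m) = L[m]) (a b c : ℕ) (hab : a < b)
    (hbc : b < c) (hc : c < L.length) :
    orient (p (E (pos + a))) (p (E (pos + b))) (p (E (pos + c))) < 0 := by
  rw [hE a (by omega), hE b (by omega), hE c hc]
  exact hL.clockwise a b c hab hbc hc

theorem IsHullList.stored_of_mem (hL : IsHullList p S L)
    (hE : ∀ (m : ℕ) (hm : m < L.length), E (pos + m) = L[m]) {z : ℝ × ℝ}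
    (hz : z ∈ hullVertices p S) : ∃ a < L.length, p (E (pos + a)) = z := by
  rw [← hL.vertices] at hz
  obtain ⟨e, he, rfl⟩ := List.mem_map.1 hz
  obtain ⟨a, ha, rfl⟩ := List.mem_iff_getElem.1 he
  exact ⟨a, ha, by rw [hE a ha]⟩

theorem IsHullList.isChain_desc (hL : IsHullList p S L)
    (hE : ∀ (m : ℕ) (hm : m < L.length), E (pos + m) = L[m]) (hμ : μ < L.length)
    (hmin : ∀ e ∈ S, toLex (p (E (pos + μ))) ≤ toLex (p e)) : IsChain p S E pos (pos + μ) := by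
  refine ⟨by omega, fun a ha ha' => ?_, fun a b ha hab hb => ?_, fun a b d ha hab hbd hd => ?_⟩
  · obtain ⟨a, rfl⟩ := Nat.exists_eq_add_of_le ha
    exact hL.stored_mem hE (by omega)
  · obtain ⟨a, rfl⟩ := Nat.exists_eq_add_of_le ha
    obtain ⟨b, rfl⟩ := Nat.exists_eq_add_of_le (ha.trans hab.le)
    exact clockwise_desc (f := fun a => p (E (pos + a))) hμ (hL.inj hE)
      (fun a ha => hL.stored_zero hE hμ (hL.stored_mem hE ha))
      (fun a ha => hmin _ (hL.stored_mem hE ha)) (hL.stored_clockwise hE) (by omega) (by omega)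
  · obtain ⟨a, rfl⟩ := Nat.exists_eq_add_of_le ha
    obtain ⟨b, rfl⟩ := Nat.exists_eq_add_of_le (ha.trans hab.le)
    obtain ⟨d, rfl⟩ := Nat.exists_eq_add_of_le (ha.trans (hab.trans hbd).le)
    exact hL.stored_clockwise hE a b d (by omega) (by omega) (by omega)

theorem IsHullList.isChain_asc (hL : IsHullList p S L)
    (hE : ∀ (m : ℕ) (hm : m < L.length), E (pos + m) = L[m]) (hμ : μ < L.length)
    (hmin : ∀ e ∈ S, toLex (p (E (pos + μ))) ≤ toLex (p e)) :
    IsChain (fun e => -p e) S E (pos + μ) (pos + L.length - 1) := by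
  refine ⟨by omega, fun a ha ha' => ?_, fun a b ha hab hb => ?_, fun a b d ha hab hbd hd => ?_⟩
  · obtain ⟨a, rfl⟩ := Nat.exists_eq_add_of_le ((Nat.le_add_right pos μ).trans ha)
    exact hL.stored_mem hE (by omega)
  · obtain ⟨a, rfl⟩ := Nat.exists_eq_add_of_le ((Nat.le_add_right pos μ).trans ha)
    obtain ⟨b, rfl⟩ := Nat.exists_eq_add_of_le ((Nat.le_add_right pos μ).trans (ha.trans hab.le))
    exact toLex_neg_lt.2 (clockwise_asc (f := fun a => p (E (pos + a))) hμ (hL.inj hE)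
      (fun a ha => hL.stored_zero hE hμ (hL.stored_mem hE ha))
      (fun a ha => hmin _ (hL.stored_mem hE ha)) (hL.stored_clockwise hE) (by omega) (by omega)
      (by omega))
  · obtain ⟨a, rfl⟩ := Nat.exists_eq_add_of_le ((Nat.le_add_right pos μ).trans ha)
    obtain ⟨b, rfl⟩ := Nat.exists_eq_add_of_le ((Nat.le_add_right pos μ).trans (ha.trans hab.le))
    obtain ⟨d, rfl⟩ :=
      Nat.exists_eq_add_of_le ((Nat.le_add_right pos μ).trans (ha.trans (hab.trans hbd).le))
    rw [orient_neg]
    exact hL.stored_clockwise hE a b d (by omega) (by omega) (by omega)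

/-- A lower vertex is extreme, hence listed. After position `μ` it would form a clockwise triple
with the largest and the smallest vertex, and thus be on the wrong side of the segment between them.
-/
theorem IsHullList.exists_of_isLower (hL : IsHullList p S L) (hS : S.Finite)
    (hE : ∀ (m : ℕ) (hm : m < L.length), E (pos + m) = L[m]) (hμ : μ < L.length)
    (hmin : ∀ e ∈ S, toLex (p (E (pos + μ))) ≤ toLex (p e)) {u : ℕ} (hu : u ∈ S)
    (h : IsLower p S (p u)) : ∃ q, pos ≤ q ∧ q ≤ pos + μ ∧ p (E q) = p u := by
  obtain ⟨a, ha, hau⟩ := hL.stored_of_mem hE (h.mem_hullVertices hS hu)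
  rcases Nat.lt_or_ge μ a with hlt | hle
  · exfalso
    rcases Nat.eq_zero_or_pos μ with rfl | hμ0
    · exact hL.inj hE 0 a hlt ha (toLex.injective (le_antisymm (hmin _ (hL.stored_mem hE ha))
        (hL.stored_zero hE hμ (hL.stored_mem hE ha))))
    · have h1 := hL.stored_clockwise hE 0 μ a hμ0 hlt ha
      have h2 := h _ (hL.stored_mem hE (show 0 < L.length by omega)) _ (hL.stored_mem hE hμ)
        ((hmin u hu).lt_of_ne fun he => hL.inj hE μ a hlt ha (by
          rw [hau]; exact toLex.injective he))
        ((hL.stored_zero hE hμ hu).lt_of_ne fun he => hL.inj hE 0 a (by omega) ha (by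
          rw [hau]; exact (toLex.injective he).symm))
      rw [hau, orient_swap] at h1
      linarith
  · exact ⟨pos + a, by omega, by omega, hau⟩

/-- Here the largest vertex is exceptional: it ends the upper hull, but is stored at the beginning
of the list. -/
theorem IsHullList.exists_of_isLower_neg (hL : IsHullList p S L) (hS : S.Finite)
    (hE : ∀ (m : ℕ) (hm : m < L.length), E (pos + m) = L[m]) (hμ : μ < L.length)
    (hmin : ∀ e ∈ S, toLex (p (E (pos + μ))) ≤ toLex (p e)) {u : ℕ} (hu : u ∈ S)
    (h : IsLower (fun e => -p e) S (-p u)) :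
    p (E pos) = p u ∨ ∃ q, pos + μ ≤ q ∧ q ≤ pos + L.length - 1 ∧ p (E q) = p u := by
  obtain ⟨a, ha, hau⟩ := hL.stored_of_mem hE (mem_hullVertices_of_isLower_neg hS hu h)
  rcases Nat.eq_zero_or_pos a with rfl | ha0
  · exact .inl hau
  rcases Nat.lt_or_ge a μ with hlt | hle
  · exfalso
    have h1 := hL.stored_clockwise hE 0 a μ ha0 hlt hμ
    have h2 := h _ (hL.stored_mem hE hμ) _ (hL.stored_mem hE (show 0 < L.length by omega))
      (toLex_neg_lt.2 ((hL.stored_zero hE hμ hu).lt_of_ne fun he => hL.inj hE 0 a ha0 ha (by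
          rw [hau]; exact (toLex.injective he).symm)))
      (toLex_neg_lt.2 ((hmin u hu).lt_of_ne fun he => hL.inj hE a μ hlt hμ (by
          rw [hau]; exact (toLex.injective he).symm)))
    rw [orient_neg] at h2
    rw [hau] at h1
    unfold orient at h1 h2
    linarith
  · exact .inr ⟨pos + a, by omega, by omega, hau⟩

theorem IsHullList.length_le_ncard (hL : IsHullList p S L) (hS : S.Finite) :
    L.length ≤ S.ncard := by
  rw [← List.toFinset_card_of_nodup hL.nodup.of_map, ← Set.ncard_coe_finset]
  exact Set.ncard_le_ncard (fun e he => hL.mem e (by simpa using he)) hS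

end StoredHull

/-! ### Assembling the hull from its lower and upper part -/

/-- `D` lists the vertices of the lower hull from right to left up to the event `v`. -/
structure LowerPrefix (Q : ℕ → ℝ × ℝ) (S : Set ℕ) (D : List ℕ) (v : ℕ) : Prop where
  sorted : D.Pairwise fun a b => toLex (Q b) < toLex (Q a)
  mem : ∀ e ∈ D, e ∈ S ∧ IsLower Q S (Q e)
  ge : ∀ e ∈ D, toLex (Q v) ≤ toLex (Q e)
  last_mem : v ∈ D
  complete : ∀ e ∈ S, IsLower Q S (Q e) → toLex (Q v) ≤ toLex (Q e) → ∃ f ∈ D, Q f = Q e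

theorem LowerPrefix.singleton {Q : ℕ → ℝ × ℝ} {S : Set ℕ} {v : ℕ} (hv : v ∈ S)
    (hmax : ∀ e ∈ S, toLex (Q e) ≤ toLex (Q v)) : LowerPrefix Q S [v] v where
  sorted := by simp
  mem := by
    simp only [List.mem_singleton, forall_eq]
    exact ⟨hv, fun x hx y hy h h' => absurd h' (hmax x hx).not_gt⟩
  ge := by simp
  last_mem := by simp
  complete := fun e he _ hve => ⟨v, by simp, toLex.injective (le_antisymm hve (hmax e he))⟩

theorem LowerPrefix.append {Q : ℕ → ℝ × ℝ} {S : Set ℕ} {D : List ℕ} {v u : ℕ}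
    (h : LowerPrefix Q S D v) (hu : IsNext Q S v u) : LowerPrefix Q S (D ++ [u]) u where
  sorted := by
    refine List.pairwise_append.2 ⟨h.sorted, by simp, fun a ha b hb => ?_⟩
    rw [List.mem_singleton.1 hb]
    exact hu.lt.trans_le (h.ge a ha)
  mem := by
    intro e he
    rcases List.mem_append.1 he with he | he
    · exact h.mem e he
    · rw [List.mem_singleton.1 he]
      exact ⟨hu.mem, hu.isLower (h.mem v h.last_mem).2⟩
  ge := by
    intro e he
    rcases List.mem_append.1 he with he | he
    · exact hu.lt.le.trans (h.ge e he)
    · rw [List.mem_singleton.1 he]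
  last_mem := by simp
  complete := by
    intro e he hel hue
    rcases le_or_gt (toLex (Q v)) (toLex (Q e)) with hve | hev
    · obtain ⟨f, hf, hfe⟩ := h.complete e he hel hve
      exact ⟨f, List.mem_append_left _ hf, hfe⟩
    refine ⟨u, by simp, toLex.injective ?_⟩
    -- A lower vertex strictly between `u` and `v` would lie strictly below the segment joining
    -- them, which the choice of `u` forbids.
    by_contra hne
    have h1 := hel v (h.mem v h.last_mem).1 u hu.mem (hue.lt_of_ne hne) hev
    have h2 := hu.orient_nonpos he hev
    rw [orient_swap] at h1
    linarith

/-- `x` may precede `y` in the clockwise list of the vertices of the convex hull. -/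
def Precedes (p : ℕ → ℝ × ℝ) (S : Set ℕ) (x y : ℕ) : Prop :=
  let Low := fun e => e ∈ S ∧ IsLower p S (p e)
  let Upp := fun e => e ∈ S ∧ IsLower (fun e => -p e) S (-p e) ∧
    (∃ f ∈ S, toLex (p f) < toLex (p e)) ∧ ∃ g ∈ S, toLex (p e) < toLex (p g)
  Low x ∧ Low y ∧ toLex (p y) < toLex (p x) ∨ Low x ∧ Upp y ∨
    Upp x ∧ Upp y ∧ toLex (p x) < toLex (p y)

theorem isLower_neg_iff {p : ℕ → ℝ × ℝ} {S : Set ℕ} {v : ℝ × ℝ} :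
    IsLower (fun e => -p e) S (-v) ↔ ∀ x ∈ S, ∀ y ∈ S, toLex (p x) < toLex v →
      toLex v < toLex (p y) → orient (p x) v (p y) < 0 := by
  simp only [IsLower, toLex_neg_lt, orient_neg]
  exact forall₄_congr fun _ _ _ _ => ⟨fun h a b => h b a, fun h a b => h b a⟩

theorem not_isLower_of_isLower_neg {p : ℕ → ℝ × ℝ} {S : Set ℕ} {v f g : ℕ}
    (h : IsLower (fun e => -p e) S (-p v)) (hf : f ∈ S) (hfv : toLex (p f) < toLex (p v))
    (hg : g ∈ S) (hgv : toLex (p v) < toLex (p g)) : ¬ IsLower p S (p v) := by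
  intro h'
  have h1 := h' g hg f hf hfv hgv
  have h2 := isLower_neg_iff.1 h f hf g hg hfv hgv
  unfold orient at h1 h2
  linarith

theorem Precedes.ne {p : ℕ → ℝ × ℝ} {S : Set ℕ} {x y : ℕ} (h : Precedes p S x y) :
    p x ≠ p y := by
  rcases h with ⟨-, -, h⟩ | ⟨hx, hy, hyu, ⟨f, hf, hfy⟩, g, hg, hyg⟩ | ⟨-, -, h⟩
  · intro he
    rw [he] at h
    exact h.false
  · intro he
    rw [he] at hx
    exact not_isLower_of_isLower_neg hyu hf hfy hg hyg hx.2
  · intro he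
    rw [he] at h
    exact h.false

/-- Whichever of the three points is lexicographically in the middle, it is a lower or an upper
vertex, and its defining inequality for the other two is the claim up to a rotation of the triple.
Points strictly between the extremes cannot be of both kinds. -/
theorem Precedes.orient_neg {p : ℕ → ℝ × ℝ} {S : Set ℕ} {a b c : ℕ} (hab : Precedes p S a b)
    (hbc : Precedes p S b c) (hac : Precedes p S a c) : orient (p a) (p b) (p c) < 0 := by
  have nab := fun h => hab.ne (toLex.injective h)
  have nbc := fun h => hbc.ne (toLex.injective h)
  have nac := fun h => hac.ne (toLex.injective h)
  have contra : ∀ {z : ℕ}, z ∈ S ∧ IsLower p S (p z) →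
      (z ∈ S ∧ IsLower (fun e => -p e) S (-p z) ∧
        (∃ f ∈ S, toLex (p f) < toLex (p z)) ∧ ∃ g ∈ S, toLex (p z) < toLex (p g)) → False := by
    rintro z ⟨-, hz⟩ ⟨-, hz', ⟨f, hf, hfz⟩, g, hg, hzg⟩
    exact not_isLower_of_isLower_neg hz' hf hfz hg hzg hz
  rcases hab with ⟨ha, hb, hlt⟩ | ⟨ha, hb⟩ | ⟨ha, hb, hlt⟩
  · rcases hbc with ⟨-, hc, hlt'⟩ | ⟨-, hc⟩ | ⟨hb', -⟩
    · exact hb.2 a ha.1 c hc.1 hlt' hlt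
    · rcases lt_or_gt_of_ne nbc with h1 | h1
      · rcases lt_or_gt_of_ne nac with h2 | h2
        · rw [orient_rotate, orient_rotate]
          exact ha.2 c hc.1 b hb.1 hlt h2
        · rw [orient_rotate]
          exact isLower_neg_iff.1 hc.2.1 b hb.1 a ha.1 h1 h2
      · exact hb.2 a ha.1 c hc.1 h1 hlt
    · exact (contra hb hb').elim
  · rcases hbc with ⟨hb', -⟩ | ⟨hb', -⟩ | ⟨-, hc, hlt'⟩
    · exact (contra hb' hb).elim
    · exact (contra hb' hb).elim
    · rcases lt_or_gt_of_ne nab with h1 | h1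
      · exact isLower_neg_iff.1 hb.2.1 a ha.1 c hc.1 h1 hlt'
      · rcases lt_or_gt_of_ne nac with h2 | h2
        · rw [orient_rotate, orient_rotate]
          exact ha.2 c hc.1 b hb.1 h1 h2
        · rw [orient_rotate]
          exact isLower_neg_iff.1 hc.2.1 b hb.1 a ha.1 hlt' h2
  · rcases hbc with ⟨hb', -⟩ | ⟨hb', -⟩ | ⟨-, hc, hlt'⟩
    · exact (contra hb' hb).elim
    · exact (contra hb' hb).elim
    · exact isLower_neg_iff.1 hb.2.1 a ha.1 c hc.1 hlt hlt'

section Assembly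

variable {p : ℕ → ℝ × ℝ} {S : Set ℕ} {e₀ v₁ v₂ : ℕ} {D₁ D₂ : List ℕ}

/-- The smallest point `v₁` ends the first march and begins the second, so it is listed only once.
The second march ends at the largest point, already listed as `e₀`, so its last entry is dropped. -/
theorem isHullList_of_lowerPrefix (hS : S.Finite) (h₁ : LowerPrefix p S (e₀ :: D₁) v₁)
    (hmax : ∀ e ∈ S, toLex (p e) ≤ toLex (p e₀)) (hmin : ∀ e ∈ S, toLex (p v₁) ≤ toLex (p e))
    (h₂ : LowerPrefix (fun e => -p e) S (v₁ :: D₂) v₂)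
    (hmax₂ : ∀ e ∈ S, toLex (p e) ≤ toLex (p v₂)) :
    IsHullList p S (e₀ :: D₁ ++ D₂.dropLast) := by
  have hDmem : ∀ e ∈ D₂.dropLast, e ∈ v₁ :: D₂ := fun e he =>
    List.mem_cons_of_mem _ (List.dropLast_subset _ he)
  have hv₁ := (h₁.mem v₁ h₁.last_mem).1
  have hs := h₂.sorted
  simp only [toLex_neg_lt] at hs
  have hlow : ∀ e ∈ D₂.dropLast, ∃ f ∈ S, toLex (p f) < toLex (p e) := fun e he =>
    ⟨v₁, hv₁, (List.pairwise_cons.1 hs).1 e (List.dropLast_subset _ he)⟩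
  have hupp : ∀ e ∈ D₂.dropLast, ∃ g ∈ S, toLex (p e) < toLex (p g) := by
    intro e he
    rcases List.eq_nil_or_concat D₂ with rfl | ⟨D, g, rfl⟩
    · simp at he
    · rw [List.concat_eq_append, List.dropLast_concat] at he
      have := (List.pairwise_append.1 (by simpa using (List.pairwise_cons.1 hs).2)).2.2 e he g
        (by simp)
      exact ⟨g, (h₂.mem g (by simp)).1, this⟩
  have hpw : (e₀ :: D₁ ++ D₂.dropLast).Pairwise (Precedes p S) := by
    refine List.pairwise_append.2 ⟨?_, ?_, ?_⟩
    · exact h₁.sorted.imp_of_mem fun {a b} ha hb hab =>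
        .inl ⟨h₁.mem a ha, h₁.mem b hb, hab⟩
    · refine ((List.pairwise_cons.1 hs).2.sublist (List.dropLast_sublist _)).imp_of_mem
        fun {a b} ha hb hab => .inr (.inr ⟨?_, ?_, hab⟩)
      · have := h₂.mem a (hDmem a ha)
        exact ⟨this.1, this.2, hlow a ha, hupp a ha⟩
      · have := h₂.mem b (hDmem b hb)
        exact ⟨this.1, this.2, hlow b hb, hupp b hb⟩
    · intro a ha b hb
      have := h₂.mem b (hDmem b hb)
      exact .inr (.inl ⟨h₁.mem a ha, this.1, this.2, hlow b hb, hupp b hb⟩)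
  refine ⟨fun e he => ?_, ?_, ?_, ?_, fun a b c hab hbc hc => ?_⟩
  · rcases List.mem_append.1 he with he | he
    · exact (h₁.mem e he).1
    · exact (h₂.mem e (hDmem e he)).1
  · exact List.pairwise_map.2 (hpw.imp fun h => h.ne)
  · ext z
    simp only [List.mem_map, Set.mem_ofPred_eq]
    constructor
    · rintro ⟨e, he, rfl⟩
      rcases List.mem_append.1 he with he | he
      · have := h₁.mem e he
        exact this.2.mem_hullVertices hS this.1
      · have := h₂.mem e (hDmem e he)
        exact mem_hullVertices_of_isLower_neg hS this.1 this.2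
    · intro hz
      obtain ⟨e, he, rfl⟩ := hullVertices_subset hz
      have hlower : IsLower p S (p e) → ∃ a ∈ e₀ :: D₁ ++ D₂.dropLast, p a = p e := fun hl => by
        obtain ⟨f, hf, hfe⟩ := h₁.complete e he hl (hmin e he)
        exact ⟨f, List.mem_append_left _ hf, hfe⟩
      rcases isLower_or_of_mem_hullVertices hz with hl | hl
      · exact hlower hl
      obtain ⟨f, hf, hfe⟩ := h₂.complete e he hl
        (by simpa [← not_lt, toLex_neg_lt] using hmax₂ e he)
      have hfe : p f = p e := neg_injective hfe
      rcases List.mem_cons.1 hf with rfl | hf'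
      · exact ⟨f, List.mem_append_left _ h₁.last_mem, hfe⟩
      rcases List.eq_nil_or_concat D₂ with rfl | ⟨D, g, rfl⟩
      · simp at hf'
      simp only [List.concat_eq_append, List.mem_append, List.mem_singleton,
        List.dropLast_concat] at hf' ⊢
      rcases hf' with hf' | rfl
      · exact ⟨f, .inr hf', hfe⟩
      -- The dropped entry may be another event than `e₀`, but it has the same, largest, point.
      · refine ⟨e₀, by simp, ?_⟩
        rw [← hfe]
        refine toLex.injective (le_antisymm ?_ (hmax f (h₂.mem f hf).1))
        refine (hmax₂ e₀ (h₁.mem e₀ (by simp)).1).trans ?_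
        have hv := h₂.last_mem
        rw [List.concat_eq_append, ← List.cons_append] at hv hs
        rcases List.mem_append.1 hv with hv | hv
        · exact ((List.pairwise_append.1 hs).2.2 v₂ hv f (by simp)).le
        · rw [List.mem_singleton.1 hv]
  · intro e he f hf
    simp only [List.cons_append, List.head?_cons, Option.mem_def, Option.some.injEq] at he
    rw [lexLE_iff, ← he]
    exact hmax f hf
  · have hpw := List.pairwise_iff_getElem.1 hpw
    exact (hpw a b _ _ hab).orient_neg (hpw b c _ hc hbc) (hpw a c _ hc (hab.trans hbc))

/-- If the second march does not move, the smallest point is also the largest, so all points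
coincide. In this case there is no repeated final entry to drop; `finish` makes the distinction. -/
theorem eq_nil_of_lowerPrefix (h₁ : LowerPrefix p S (e₀ :: D₁) v₁)
    (hmin : ∀ e ∈ S, toLex (p v₁) ≤ toLex (p e))
    (h₂ : LowerPrefix (fun e => -p e) S [v₁] v₂)
    (hmax₂ : ∀ e ∈ S, toLex (p e) ≤ toLex (p v₂)) : D₁ = [] := by
  obtain rfl := List.mem_singleton.1 h₂.last_mem
  refine List.eq_nil_iff_forall_not_mem.2 fun f hf => ?_
  have h3 := (List.pairwise_cons.1 h₁.sorted).1 f hf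
  have h4 := hmin f (h₁.mem f (by simp [hf])).1
  have h5 := hmax₂ e₀ (h₁.mem e₀ (by simp)).1
  exact absurd (h3.trans_le (h5.trans h4)) (lt_irrefl _)

end Assembly

open RealRAM

/-! ### Tests on points -/

infixr:60 " ;; " => RealRAM.Prog.seq

/-- The array of the addresses of the nodes whose canonical subsets form the window. -/
abbrev nodeArr : ℕ := 11

/-- First coordinate of the point of an event, multiplied by the sign in the real register `0`. -/
def qx (e : IExp) : RExp := .mul (.reg 0) (.load xArr e)

/-- The second coordinate, with the same sign. -/
def qy (e : IExp) : RExp := .mul (.reg 0) (.load yArr e)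

/-- Disjunction of tests. -/
def bor (b c : BExp) : BExp := .not (.and (.not b) (.not c))

/-- Equality of reals. -/
def req (e f : RExp) : BExp := .and (.not (.rlt e f)) (.not (.rlt f e))

/-- Lexicographic comparison of points of events. -/
def lexLt (e f : IExp) : BExp :=
  bor (.rlt (qx e) (qx f)) (.and (req (qx e) (qx f)) (.rlt (qy e) (qy f)))

/-- Orientation of points of events. -/
def orientE (a b c : IExp) : RExp :=
  .sub (.mul (.sub (qx b) (qx a)) (.sub (qy c) (qy a)))
    (.mul (.sub (qy b) (qy a)) (.sub (qx c) (qx a)))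

/-- In the state `s`, the signed coordinates of the events in `S` are those of `Q`. -/
def Coord (s : State) (Q : ℕ → ℝ × ℝ) (S : Set ℕ) : Prop :=
  ∀ e ∈ S, s.rreg 0 * s.rarr xArr e = (Q e).1 ∧ s.rreg 0 * s.rarr yArr e = (Q e).2

theorem bor_holds {b c : BExp} {s : State} : (bor b c).holds s ↔ b.holds s ∨ c.holds s := by
  simp only [bor, BExp.holds]
  tauto

theorem req_holds {e f : RExp} {s : State} : (req e f).holds s ↔ e.val s = f.val s := by
  simp only [req, BExp.holds, not_lt]
  exact ⟨fun h => le_antisymm h.2 h.1, fun h => ⟨h.ge, h.le⟩⟩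

theorem Coord.qx_val {s : State} {Q : ℕ → ℝ × ℝ} {S : Set ℕ} (h : Coord s Q S) {e : IExp}
    (he : e.val s ∈ S) : (qx e).val s = (Q (e.val s)).1 := (h _ he).1

theorem Coord.qy_val {s : State} {Q : ℕ → ℝ × ℝ} {S : Set ℕ} (h : Coord s Q S) {e : IExp}
    (he : e.val s ∈ S) : (qy e).val s = (Q (e.val s)).2 := (h _ he).2

theorem Coord.lexLt_holds {s : State} {Q : ℕ → ℝ × ℝ} {S : Set ℕ} (h : Coord s Q S)
    {e f : IExp} (he : e.val s ∈ S) (hf : f.val s ∈ S) :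
    (lexLt e f).holds s ↔ toLex (Q (e.val s)) < toLex (Q (f.val s)) := by
  simp only [lexLt, bor_holds, BExp.holds, req_holds, h.qx_val he, h.qx_val hf, h.qy_val he,
    h.qy_val hf, toLex_lt_iff]

theorem Coord.orientE_val {s : State} {Q : ℕ → ℝ × ℝ} {S : Set ℕ} (h : Coord s Q S)
    {a b c : IExp} (ha : a.val s ∈ S) (hb : b.val s ∈ S) (hc : c.val s ∈ S) :
    (orientE a b c).val s = orient (Q (a.val s)) (Q (b.val s)) (Q (c.val s)) := by
  simp only [orientE, RExp.val, h.qx_val ha, h.qx_val hb, h.qx_val hc, h.qy_val ha, h.qy_val hb,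
    h.qy_val hc, orient]

/-! ### Binary search in a convex chain -/

/-- The event at a position of the hull array. -/
def ev (e : IExp) : IExp := .load hullEventArr e

/-- One step of the search. -/
def searchBody : Prog :=
  .setI 20 (.half (.add (.reg 18) (.reg 19))) ;;
  .ite (.and (lexLt (ev (.reg 20)) (.reg 7))
      (.rlt (orientE (.reg 7) (ev (.reg 20)) (ev (.add (.reg 20) (.const 1)))) (.const 0)))
    (.setI 19 (.reg 20)) (.setI 18 (.add (.reg 20) (.const 1)))

/-- Search in the chain at the positions from register `18` to register `19` for the event that
follows the event in register `7`; the result is in register `17`. -/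
def search : Prog :=
  .while (.ilt (.reg 18) (.reg 19)) searchBody ;; .setI 17 (ev (.reg 18))

theorem searchBody_runs {s : State} {Q : ℕ → ℝ × ℝ} {S : Set ℕ} (hco : Coord s Q S)
    (hv : s.ireg 7 ∈ S)
    (hE : ∀ q, s.ireg 18 ≤ q → q ≤ s.ireg 19 → s.iarr hullEventArr q ∈ S)
    (hlt : s.ireg 18 < s.ireg 19) {P : ℕ → Prop}
    (hP : ∀ q, P q ↔ (toLex (Q (s.iarr hullEventArr q)) < toLex (Q (s.ireg 7)) ∧
      orient (Q (s.ireg 7)) (Q (s.iarr hullEventArr q)) (Q (s.iarr hullEventArr (q + 1))) < 0)) :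
    Runs searchBody s searchBody.cost fun s' => Keeps 17 s s' ∧ ∃ q, s.ireg 18 ≤ q ∧
      q < s.ireg 19 ∧ 2 * q ≤ s.ireg 18 + s.ireg 19 ∧ s.ireg 18 + s.ireg 19 ≤ 2 * q + 1 ∧
      (P q ∧ s'.ireg 18 = s.ireg 18 ∧ s'.ireg 19 = q ∨
        ¬ P q ∧ s'.ireg 18 = q + 1 ∧ s'.ireg 19 = s.ireg 19) := by
  apply Prog.runs_of_wp
  have hm1 : s.ireg 18 ≤ (s.ireg 18 + s.ireg 19) / 2 := by omega
  have hm2 : (s.ireg 18 + s.ireg 19) / 2 < s.ireg 19 := by omega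
  change Prog.wp (.ite _ _ _) _ { s with ireg := Function.update s.ireg 20 _ }
  generalize hs1 : ({ s with ireg := Function.update s.ireg 20 _ } : State) = s1
  simp only [Prog.wp]
  have hco1 : Coord s1 Q S := by rw [← hs1]; exact hco
  have k7 : s1.ireg 7 = s.ireg 7 := by simp [← hs1]
  have k20 : s1.ireg 20 = (s.ireg 18 + s.ireg 19) / 2 := by simp [← hs1, IExp.val]
  have k9 : s1.iarr = s.iarr := by rw [← hs1]
  have a7 : (IExp.reg 7).val s1 ∈ S := by simpa [IExp.val, k7] using hv
  have a20 : (ev (.reg 20)).val s1 ∈ S := by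
    simpa [ev, IExp.val, k20, k9] using hE _ hm1 hm2.le
  have a21 : (ev (.add (.reg 20) (.const 1))).val s1 ∈ S := by
    simpa [ev, IExp.val, k20, k9] using hE ((s.ireg 18 + s.ireg 19) / 2 + 1) (by omega) (by omega)
  have hb : (BExp.and (lexLt (ev (.reg 20)) (.reg 7))
      (.rlt (orientE (.reg 7) (ev (.reg 20)) (ev (.add (.reg 20) (.const 1)))) (.const 0))).holds
      s1 ↔ P ((s.ireg 18 + s.ireg 19) / 2) := by
    rw [BExp.holds, hco1.lexLt_holds a20 a7, BExp.holds, hco1.orientE_val a7 a20 a21, hP]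
    simp [ev, IExp.val, RExp.val, k7, k20, k9]
  rw [hb]
  have hk : ∀ r v, 17 ≤ r → Keeps 17 s { s1 with ireg := Function.update s1.ireg r v } := by
    intro r v hr
    rw [← hs1]
    refine ⟨rfl, rfl, rfl, fun r' hr' => ?_⟩
    simp only [Function.update_apply]
    rw [if_neg (by omega), if_neg (by omega)]
  refine ⟨fun h => ⟨hk _ _ (by omega), _, hm1, hm2, by omega, by omega, .inl ⟨h, ?_⟩⟩,
    fun h => ⟨hk _ _ (by omega), _, hm1, hm2, by omega, by omega, .inr ⟨h, ?_⟩⟩⟩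
  · simp [IExp.val, ← hs1]
  · simp [IExp.val, ← hs1]

/-- Two guarantees of different strength: the result is always an event of `S`, and it has the point
of the successor if the chain contains that point. Only in the second case is the predicate `P`
monotone, so the invariant speaks of the threshold `q₀` conditionally. -/
theorem search_runs {s : State} {Q : ℕ → ℝ × ℝ} {S : Set ℕ} {k : ℕ} (hco : Coord s Q S)
    (hv : s.ireg 7 ∈ S) (hc : IsChain Q S (s.iarr hullEventArr) (s.ireg 18) (s.ireg 19))
    (hk : s.ireg 19 - s.ireg 18 < 2 ^ k) :
    Runs search s ((k + 1) * (searchBody.cost + 4) + 3) fun s' => Keeps 17 s s' ∧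
      s'.ireg 17 ∈ S ∧ ∀ u q₀, IsNext Q S (s.ireg 7) u → s.ireg 18 ≤ q₀ → q₀ ≤ s.ireg 19 →
        Q (s.iarr hullEventArr q₀) = Q u → Q (s'.ireg 17) = Q u := by
  let P : ℕ → Prop := fun q => toLex (Q (s.iarr hullEventArr q)) < toLex (Q (s.ireg 7)) ∧
      orient (Q (s.ireg 7)) (Q (s.iarr hullEventArr q)) (Q (s.iarr hullEventArr (q + 1))) < 0
  refine Runs.seq (Runs.while (fun k s' => Keeps 17 s s' ∧ s.ireg 18 ≤ s'.ireg 18 ∧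
      s'.ireg 18 ≤ s'.ireg 19 ∧ s'.ireg 19 ≤ s.ireg 19 ∧ s'.ireg 19 - s'.ireg 18 < 2 ^ k ∧
      ∀ q₀, s.ireg 18 ≤ q₀ → q₀ ≤ s.ireg 19 →
        (∀ q, s.ireg 18 ≤ q → q < s.ireg 19 → (P q ↔ q₀ ≤ q)) →
        s'.ireg 18 ≤ q₀ ∧ q₀ ≤ s'.ireg 19)
    (T := searchBody.cost)
    (R := fun s' => Keeps 17 s s' ∧ s.ireg 18 ≤ s'.ireg 18 ∧ s'.ireg 18 ≤ s.ireg 19 ∧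
      ∀ q₀, s.ireg 18 ≤ q₀ → q₀ ≤ s.ireg 19 →
        (∀ q, s.ireg 18 ≤ q → q < s.ireg 19 → (P q ↔ q₀ ≤ q)) → s'.ireg 18 = q₀)
    ?_ ?_ k s ⟨.refl _ _, le_rfl, hc.le, le_rfl, hk, fun q₀ h h' _ => ⟨h, h'⟩⟩) ?_
  · rintro k s' ⟨hK, h1, h2, h3, h4, h5⟩ hb
    have hb : s'.ireg 18 < s'.ireg 19 := hb
    obtain _ | k := k
    · omega
    refine ⟨k, rfl, (searchBody_runs (P := P) (Q := Q) (S := S) ?_ ?_ ?_ hb ?_).mono le_rfl ?_⟩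
    · intro e he
      rw [hK.rreg, hK.rarr]
      exact hco e he
    · rwa [hK.ireg 7 (by omega)]
    · intro q hq hq'
      rw [hK.iarr]
      exact hc.mem q (by omega) (by omega)
    · intro q
      rw [hK.iarr, hK.ireg 7 (by omega)]
    · rw [pow_succ] at h4
      rintro s'' ⟨hK', q, hq1, hq2, hq3, hq4, ⟨hPq, e1, e2⟩ | ⟨hPq, e1, e2⟩⟩
      · refine ⟨hK.trans hK' le_rfl, by omega, by omega, by omega, by omega, fun q₀ a b c => ?_⟩
        have h6 := h5 q₀ a b c
        have h7 := (c q (by omega) (by omega)).1 hPq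
        omega
      · refine ⟨hK.trans hK' le_rfl, by omega, by omega, by omega, by omega, fun q₀ a b c => ?_⟩
        have h6 := h5 q₀ a b c
        have h7 := mt (c q (by omega) (by omega)).2 hPq
        omega
  · rintro k s' ⟨hK, h1, h2, h3, h4, h5⟩ hb
    have hb : ¬ s'.ireg 18 < s'.ireg 19 := hb
    refine ⟨hK, h1, by omega, fun q₀ a b c => ?_⟩
    have := h5 q₀ a b c
    omega
  · rintro s' ⟨hK, h1, h2, h3⟩
    refine Prog.runs_of_wp _ _ _ ⟨⟨hK.iarr, hK.rarr, hK.rreg, fun r hr => ?_⟩, ?_, ?_⟩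
    · exact (Function.update_of_ne (by omega) _ _).trans (hK.ireg r hr)
    · simpa [ev, IExp.val, hK.iarr] using hc.mem _ h1 h2
    · intro u q₀ hu a b hq
      have := h3 q₀ a b fun q hq' hq'' => hu.search hc a b hq hq' hq''
      simpa [ev, IExp.val, hK.iarr, this] using hq

/-! ### The event that follows a given event on the hull -/

/-- Register contents while the candidates satisfying `U` have been inspected: `f` tells whether
a candidate `b` has been found. -/
def IsBest (Q : ℕ → ℝ × ℝ) (S : Set ℕ) (v : ℕ) (U : ℕ → Prop) (f b : ℕ) : Prop :=
  (f = 0 ∨ f = 1 ∧ b ∈ S ∧ toLex (Q b) < toLex (Q v)) ∧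
    ∀ u, IsNext Q S v u → U u → f = 1 ∧ Q b = Q u

/-- Compare the candidate in register `17` with the best one so far. -/
def consider : Prog :=
  .ite (lexLt (.reg 17) (.reg 7))
    (.ite (.ieq (.reg 12) (.const 0))
      (.setI 13 (.reg 17) ;; .setI 12 (.const 1))
      (.ite (bor (.rlt (.const 0) (orientE (.reg 7) (.reg 13) (.reg 17)))
          (.and (req (orientE (.reg 7) (.reg 13) (.reg 17)) (.const 0))
            (lexLt (.reg 17) (.reg 13))))
        (.setI 13 (.reg 17)) .skip))
    .skip

/-- The test for replacement is the strict part of the order of directions from `v`, with the same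
rule for ties as in `IsNext`. So the successor is never replaced by a different point, and replaces
any other candidate. Equality is one of points, since several events may share a point. -/
theorem consider_runs {s : State} {Q : ℕ → ℝ × ℝ} {S : Set ℕ} {U : ℕ → Prop}
    (hco : Coord s Q S) (hv : s.ireg 7 ∈ S) (hx : s.ireg 17 ∈ S)
    (hb : IsBest Q S (s.ireg 7) U (s.ireg 12) (s.ireg 13)) :
    Runs consider s consider.cost fun s' => Keeps 12 s s' ∧ (∀ r, 13 < r → s'.ireg r = s.ireg r) ∧
      IsBest Q S (s.ireg 7) (fun u => U u ∨ Q (s.ireg 17) = Q u) (s'.ireg 12) (s'.ireg 13) := by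
  apply Prog.runs_of_wp
  have h7 : (IExp.reg 7).val s ∈ S := hv
  have h17 : (IExp.reg 17).val s ∈ S := hx
  have hkeep : ∀ r v, 12 ≤ r → Keeps 12 s { s with ireg := Function.update s.ireg r v } :=
    fun r v hr => ⟨rfl, rfl, rfl, fun r' hr' => Function.update_of_ne (by omega) _ _⟩
  simp only [consider, Prog.wp]
  rw [hco.lexLt_holds h17 h7]
  simp only [IExp.val, BExp.holds]
  obtain ⟨hb1, hb2⟩ := hb
  refine ⟨fun hlt => ⟨fun h0 => ?_, fun h0 => ?_⟩, fun hlt => ?_⟩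
  · refine ⟨⟨rfl, rfl, rfl, fun r hr => ?_⟩, fun r hr => ?_, ?_⟩
    · simp only [Function.update_apply]
      rw [if_neg (by omega), if_neg (by omega)]
    · simp only [Function.update_apply]
      rw [if_neg (by omega), if_neg (by omega)]
    · simp only [Function.update_apply]
      refine ⟨.inr ⟨by simp, hx, hlt⟩, fun u hu hU => ⟨by simp, ?_⟩⟩
      rcases hU with hU | hU
      · have := (hb2 u hu hU).1
        omega
      · exact hU
  · obtain ⟨h1, hbS, hbv⟩ := hb1.resolve_left h0
    have h13 : (IExp.reg 13).val s ∈ S := hbS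
    rw [bor_holds]
    simp only [BExp.holds]
    rw [req_holds, hco.lexLt_holds h17 h13, hco.orientE_val h7 h13 h17]
    simp only [RExp.val, IExp.val, Int.cast_zero]
    refine ⟨fun ht => ?_, fun ht => ?_⟩
    · refine ⟨hkeep _ _ (by omega), fun r hr => Function.update_of_ne (by omega) _ _, ?_⟩
      simp only [Function.update_apply]
      refine ⟨.inr ⟨by simpa using h1, by simpa using hx, by simpa using hlt⟩,
        fun u hu hU => ⟨by simpa using h1, ?_⟩⟩
      simp only [if_true]
      rcases hU with hU | hU
      · exfalso
        have hbu := (hb2 u hu hU).2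
        rw [hbu] at ht
        have hd := hu.dom _ hx hlt
        rcases hd with hd | ⟨hd, hd'⟩
        · rcases ht with ht | ⟨ht, -⟩ <;> linarith
        · rcases ht with ht | ⟨-, ht⟩
          · linarith
          · exact hd'.not_gt ht
      · exact hU
    · refine ⟨.refl _ _, by simp, hb1, fun u hu hU => ⟨h1, ?_⟩⟩
      rcases hU with hU | hU
      · exact (hb2 u hu hU).2
      · by_contra hne
        refine ht ?_
        rw [hU]
        have hd := hu.dom _ hbS hbv
        rw [orient_swap] at hd
        rcases hd with hd | ⟨hd, hd'⟩
        · exact .inl (by linarith)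
        · exact .inr ⟨by linarith, hd'.lt_of_ne fun he => hne (toLex.injective he).symm⟩
  · refine ⟨.refl _ _, by simp, hb1, fun u hu hU => ?_⟩
    rcases hU with hU | hU
    · exact hb2 u hu hU
    · rw [hU] at hlt
      exact absurd hu.lt hlt

/-- Position of the hull of the `m`-th node of the window. -/
def hullPos (s : State) (m : ℕ) : ℕ := s.iarr hullPosArr (s.iarr nodeArr m)

/-- First position of the chain of the `m`-th node that is relevant for the current phase. -/
def chainLo (s : State) (m : ℕ) : ℕ :=
  if s.ireg 5 = 0 then hullPos s m else hullPos s m + s.iarr hullMinArr (s.iarr nodeArr m)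

/-- Last position of the chain of the `m`-th node that is relevant for the current phase. -/
def chainHi (s : State) (m : ℕ) : ℕ :=
  if s.ireg 5 = 0 then hullPos s m + s.iarr hullMinArr (s.iarr nodeArr m)
  else hullPos s m + s.iarr hullLenArr (s.iarr nodeArr m) - 1

/-- The event `u` has the same point as a candidate provided by the `m`-th node. -/
def IsCandidate (s : State) (Q : ℕ → ℝ × ℝ) (u m : ℕ) : Prop :=
  (∃ q, chainLo s m ≤ q ∧ q ≤ chainHi s m ∧ Q (s.iarr hullEventArr q) = Q u) ∨
    Q (s.iarr hullEventArr (hullPos s m)) = Q u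

/-- The memory is prepared for a phase on the points `Q`. -/
structure Setup (s : State) (Q : ℕ → ℝ × ℝ) (S : Set ℕ) (k : ℕ) : Prop where
  coord : Coord s Q S
  chain : ∀ m < s.ireg 6, IsChain Q S (s.iarr hullEventArr) (chainLo s m) (chainHi s m)
  size : ∀ m < s.ireg 6, chainHi s m - chainLo s m < 2 ^ k
  first : ∀ m < s.ireg 6, s.iarr hullEventArr (hullPos s m) ∈ S
  cover : ∀ u ∈ S, IsLower Q S (Q u) → ∃ m < s.ireg 6, IsCandidate s Q u m

/-- Load the positions of the chain of one node. -/
def loadChain : Prog :=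
  .setI 14 (.load nodeArr (.reg 11)) ;; .setI 16 (.load hullPosArr (.reg 14)) ;;
  .ite (.ieq (.reg 5) (.const 0))
    (.setI 18 (.reg 16) ;; .setI 19 (.add (.reg 16) (.load hullMinArr (.reg 14))))
    (.setI 18 (.add (.reg 16) (.load hullMinArr (.reg 14))) ;;
      .setI 19 (.sub (.add (.reg 16) (.load hullLenArr (.reg 14))) (.const 1)))

/-- Inspect the candidates of one node. -/
def inspectNode : Prog :=
  loadChain ;; search ;; consider ;; .setI 17 (ev (.reg 16)) ;; consider ;;
  .setI 11 (.add (.reg 11) (.const 1))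

/-- Find the event that follows the event in register `7`. -/
def findNext : Prog :=
  (.setI 12 (.const 0) ;; .setI 11 (.const 0)) ;;
  .while (.ilt (.reg 11) (.reg 6)) inspectNode

theorem IsBest.mono {Q : ℕ → ℝ × ℝ} {S : Set ℕ} {v : ℕ} {U U' : ℕ → Prop} {f b : ℕ}
    (h : IsBest Q S v U f b) (hU : ∀ u, IsNext Q S v u → U' u → U u) : IsBest Q S v U' f b :=
  ⟨h.1, fun u hu h' => h.2 u hu (hU u hu h')⟩

theorem Coord.keeps {s s' : State} {Q : ℕ → ℝ × ℝ} {S : Set ℕ} {k : ℕ} (h : Coord s Q S)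
    (hK : Keeps k s s') : Coord s' Q S := by
  intro e he
  rw [hK.rreg, hK.rarr]
  exact h e he

theorem loadChain_runs (s : State) : Runs loadChain s loadChain.cost fun s₁ => Keeps 14 s s₁ ∧
    s₁.ireg 16 = hullPos s (s.ireg 11) ∧ s₁.ireg 18 = chainLo s (s.ireg 11) ∧
    s₁.ireg 19 = chainHi s (s.ireg 11) := by
  apply Prog.runs_of_wp
  simp only [loadChain, Prog.wp, BExp.holds, IExp.val]
  refine ⟨fun h => ?_, fun h => ?_⟩
  all_goals
    refine ⟨⟨rfl, rfl, rfl, fun r hr => ?_⟩, ?_, ?_, ?_⟩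
    · simp only [Function.update_apply]
      rw [if_neg (by omega), if_neg (by omega), if_neg (by omega), if_neg (by omega)]
    · simp [hullPos]
    · simp at h
      simp [chainLo, h, hullPos]
    · simp at h
      simp [chainHi, h, hullPos]

/-- Bound for the number of steps of `inspectNode` if chains have fewer than `2 ^ k` edges. -/
def inspectCost (k : ℕ) : ℕ := (k + 1) * (searchBody.cost + 4) + inspectNode.cost

theorem inspectNode_runs {s : State} {Q : ℕ → ℝ × ℝ} {S : Set ℕ} {k : ℕ} {U : ℕ → Prop}
    (hs : Setup s Q S k) (hv : s.ireg 7 ∈ S) (hm : s.ireg 11 < s.ireg 6)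
    (hb : IsBest Q S (s.ireg 7) U (s.ireg 12) (s.ireg 13)) :
    Runs inspectNode s (inspectCost k) fun s' => Keeps 11 s s' ∧
      s'.ireg 11 = s.ireg 11 + 1 ∧
      IsBest Q S (s.ireg 7) (fun u => U u ∨ IsCandidate s Q u (s.ireg 11))
        (s'.ireg 12) (s'.ireg 13) := by
  -- In `inspectNode.cost` the loop of `search` counts as 0, so adding its bound separately counts
  -- nothing twice.
  refine Runs.mono (T := loadChain.cost + (((k + 1) * (searchBody.cost + 4) + 3) +
    (consider.cost + (Prog.cost (.setI 17 (ev (.reg 16))) +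
      (consider.cost + Prog.cost (.setI 11 (.add (.reg 11) (.const 1)))))))) ?_
      (by simp only [inspectCost, inspectNode, Prog.cost, search, ev, IExp.cost]; omega)
      fun _ h => h
  refine Runs.seq (loadChain_runs s) ?_
  rintro s₁ ⟨K₁, e16, e18, e19⟩
  have hco₁ := hs.coord.keeps K₁
  have e7 := K₁.ireg 7 (by omega)
  have hch := hs.chain _ hm
  rw [← e18, ← e19, ← K₁.iarr] at hch
  have hsz := hs.size _ hm
  rw [← e18, ← e19] at hsz
  refine Runs.seq (search_runs hco₁ (by rwa [e7]) hch hsz) ?_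
  rintro s₂ ⟨K₂, m17, hs₂⟩
  have f7 : s₂.ireg 7 = s.ireg 7 := (K₂.ireg 7 (by omega)).trans e7
  rw [e7] at hs₂
  refine Runs.seq (consider_runs (U := U) (hco₁.keeps K₂) (by rwa [f7]) m17 ?_) ?_
  · rw [f7, K₂.ireg 12 (by omega), K₁.ireg 12 (by omega), K₂.ireg 13 (by omega),
      K₁.ireg 13 (by omega)]
    exact hb
  rintro s₃ ⟨K₃, hr₃, hb₃⟩
  rw [f7] at hb₃
  have g16 : s₃.ireg 16 = hullPos s (s.ireg 11) := by
    rw [hr₃ 16 (by omega), K₂.ireg 16 (by omega), e16]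
  have g9 : s₃.iarr = s.iarr := by rw [K₃.iarr, K₂.iarr, K₁.iarr]
  refine Runs.seq (R₁ := fun s₄ => Keeps 17 s₃ s₄ ∧
    s₄.ireg 17 = s.iarr hullEventArr (hullPos s (s.ireg 11))) (Prog.runs_of_wp _ _ _ ?_) ?_
  · refine ⟨⟨rfl, rfl, rfl, fun r hr => Function.update_of_ne (by omega) _ _⟩, ?_⟩
    simp [ev, IExp.val, g9, g16]
  rintro s₄ ⟨K₄, e17⟩
  have h7 : s₄.ireg 7 = s.ireg 7 := by rw [K₄.ireg 7 (by omega), K₃.ireg 7 (by omega), f7]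
  refine Runs.seq (consider_runs (U := fun u => U u ∨ Q (s₂.ireg 17) = Q u)
    (((hco₁.keeps K₂).keeps K₃).keeps K₄) (by rwa [h7]) (by rw [e17]; exact hs.first _ hm) ?_) ?_
  · rw [h7, K₄.ireg 12 (by omega), K₄.ireg 13 (by omega)]
    exact hb₃
  rintro s₅ ⟨K₅, -, hb₅⟩
  rw [h7, e17] at hb₅
  have K : Keeps 12 s s₅ :=
    ((((K₁.weaken (by omega)).trans K₂ (by omega)).trans K₃ le_rfl).trans K₄ (by omega)).trans K₅
      le_rfl
  refine Prog.runs_of_wp _ _ _ ⟨⟨K.iarr, K.rarr, K.rreg, fun r hr =>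
    (Function.update_of_ne (by omega) _ _).trans (K.ireg r (by omega))⟩, ?_, ?_⟩
  · simp [IExp.val, K.ireg 11 (by omega)]
  · have : IsBest Q S (s.ireg 7) (fun u => U u ∨ IsCandidate s Q u (s.ireg 11))
        (s₅.ireg 12) (s₅.ireg 13) := by
      refine hb₅.mono fun u hu hU => ?_
      rcases hU with hU | ⟨q, hq, hq', hqu⟩ | hU
      · exact .inl (.inl hU)
      · refine .inl (.inr (hs₂ u q hu (by rwa [e18]) (by rwa [e19]) ?_))
        rw [K₁.iarr]
        exact hqu
      · exact .inr hU
    simpa [Function.update_apply] using this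

/-- Bound for the number of steps of `findNext` with `c` nodes. -/
def findNextCost (k c : ℕ) : ℕ := 4 + (c + 1) * (inspectCost k + 4)

/-- That the current vertex is on the lower hull makes the successor one as well, and `Setup.cover`
then provides a node with the successor among its candidates. -/
theorem findNext_runs {s : State} {Q : ℕ → ℝ × ℝ} {S : Set ℕ} {k : ℕ} (hs : Setup s Q S k)
    (hv : s.ireg 7 ∈ S) (hvl : IsLower Q S (Q (s.ireg 7))) :
    Runs findNext s (findNextCost k (s.ireg 6)) fun s' => Keeps 11 s s' ∧
      IsBest Q S (s.ireg 7) (fun _ => True) (s'.ireg 12) (s'.ireg 13) := by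
  refine Runs.seq (T₁ := 4) (R₁ := fun s' => Keeps 11 s s' ∧ s'.ireg 11 = 0 ∧ s'.ireg 12 = 0)
    (Prog.runs_of_wp _ _ _ ⟨⟨rfl, rfl, rfl, fun r hr => ?_⟩, ?_, ?_⟩) fun s₁ h₁ => ?_
  · simp only [Function.update_apply]
    rw [if_neg (by omega), if_neg (by omega)]
  · simp [IExp.val]
  · simp [IExp.val]
  obtain ⟨K₁, e11, e12⟩ := h₁
  have hset : ∀ s', Keeps 11 s s' → Setup s' Q S k := by
    intro s' hK
    have hlo : ∀ m, chainLo s' m = chainLo s m := fun m => by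
      unfold chainLo hullPos; rw [hK.iarr, hK.ireg 5 (by omega)]
    have hhi : ∀ m, chainHi s' m = chainHi s m := fun m => by
      unfold chainHi hullPos; rw [hK.iarr, hK.ireg 5 (by omega)]
    refine ⟨hs.coord.keeps hK, ?_, ?_, ?_, ?_⟩
    · simpa only [hlo, hhi, hK.iarr, hK.ireg 6 (by omega)] using hs.chain
    · simpa only [hlo, hhi, hK.iarr, hK.ireg 6 (by omega)] using hs.size
    · simpa only [hullPos, hK.iarr, hK.ireg 6 (by omega)] using hs.first
    · simpa only [IsCandidate, hlo, hhi, hullPos, hK.iarr, hK.ireg 6 (by omega)] using hs.cover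
  have hcand : ∀ s', Keeps 11 s s' → ∀ u m, IsCandidate s' Q u m ↔ IsCandidate s Q u m := by
    intro s' hK u m
    unfold IsCandidate chainLo chainHi hullPos
    rw [hK.iarr, hK.ireg 5 (by omega)]
  refine Runs.while (T := inspectCost k) (fun f s' => Keeps 11 s s' ∧
    s'.ireg 11 + f = s.ireg 6 ∧ IsBest Q S (s.ireg 7)
      (fun u => ∃ m < s'.ireg 11, IsCandidate s Q u m) (s'.ireg 12) (s'.ireg 13)) ?_ ?_ _ s₁
    ⟨K₁, by omega, .inl e12, fun u hu ⟨m, hm, _⟩ => by omega⟩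
  · rintro f s' ⟨hK, hf, hb⟩ hlt
    have hlt : s'.ireg 11 < s'.ireg 6 := hlt
    have h6 := hK.ireg 6 (by omega)
    have h7 := hK.ireg 7 (by omega)
    obtain ⟨f, rfl⟩ : ∃ f', f = f' + 1 := ⟨f - 1, by omega⟩
    refine ⟨f, rfl, (inspectNode_runs (hset s' hK) (by rwa [h7]) hlt (by rw [h7]; exact hb)).mono
      le_rfl ?_⟩
    rintro s'' ⟨hK', e, hb'⟩
    refine ⟨hK.trans hK' le_rfl, by omega, ?_⟩
    rw [h7] at hb'
    refine hb'.mono fun u hu ⟨m, hm, hc⟩ => ?_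
    rcases Nat.lt_or_ge m (s'.ireg 11) with h | h
    · exact .inl ⟨m, h, hc⟩
    · obtain rfl : m = s'.ireg 11 := by omega
      exact .inr ((hcand s' hK _ _).2 hc)
  · rintro f s' ⟨hK, hf, hb⟩ hlt
    have hlt : ¬ s'.ireg 11 < s'.ireg 6 := hlt
    have h6 := hK.ireg 6 (by omega)
    refine ⟨hK, hb.mono fun u hu _ => ?_⟩
    obtain ⟨m, hm, hc⟩ := hs.cover u hu.mem (hu.isLower hvl)
    exact ⟨m, by omega, hc⟩

/-! ### A phase -/

/-- The output consists of the events in `L`. -/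
def Out (s : State) (L : List ℕ) : Prop :=
  s.ireg 9 = L.length ∧ ∀ (m : ℕ) (hm : m < L.length), s.iarr outArr m = L[m]

/-- The states agree on all memory that is not changed by a phase. -/
structure Agree (s s' : State) : Prop where
  iarr : ∀ a, a ≠ outArr → s'.iarr a = s.iarr a
  rarr : s'.rarr = s.rarr
  rreg : s'.rreg = s.rreg
  ireg : ∀ r < 7, s'.ireg r = s.ireg r

theorem Agree.trans {s s' s'' : State} (h : Agree s s') (h' : Agree s' s'') : Agree s s'' :=
  ⟨fun a ha => (h'.iarr a ha).trans (h.iarr a ha), h'.rarr.trans h.rarr, h'.rreg.trans h.rreg,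
    fun r hr => (h'.ireg r hr).trans (h.ireg r hr)⟩

theorem Setup.agree {s s' : State} {Q : ℕ → ℝ × ℝ} {S : Set ℕ} {k : ℕ} (hs : Setup s Q S k)
    (h : Agree s s') : Setup s' Q S k := by
  have h5 := h.ireg 5 (by omega)
  have h6 := h.ireg 6 (by omega)
  have a6 := h.iarr hullPosArr (by decide)
  have a7 := h.iarr hullLenArr (by decide)
  have a8 := h.iarr hullMinArr (by decide)
  have a9 := h.iarr hullEventArr (by decide)
  have a11 := h.iarr nodeArr (by decide)
  have hlo : ∀ m, chainLo s' m = chainLo s m := fun m => by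
    unfold chainLo hullPos; rw [a6, a8, a11, h5]
  have hhi : ∀ m, chainHi s' m = chainHi s m := fun m => by
    unfold chainHi hullPos; rw [a6, a7, a8, a11, h5]
  have hpos : ∀ m, hullPos s' m = hullPos s m := fun m => by
    unfold hullPos; rw [a6, a11]
  refine ⟨?_, ?_, ?_, ?_, ?_⟩
  · intro e he
    rw [h.rreg, h.rarr]
    exact hs.coord e he
  · simpa only [hlo, hhi, a9, h6] using hs.chain
  · simpa only [hlo, hhi, h6] using hs.size
  · simpa only [hpos, a9, h6] using hs.first
  · simpa only [IsCandidate, hlo, hhi, hpos, a9, h6] using hs.cover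

/-- Find the next event and append it to the output. -/
def phaseBody : Prog :=
  findNext ;; .ite (.ieq (.reg 12) (.const 0)) (.setI 10 (.const 0))
    (.storeI outArr (.reg 9) (.reg 13) ;; .setI 9 (.add (.reg 9) (.const 1)) ;;
      .setI 7 (.reg 13))

/-- List the events on the lower hull from the event in register `7` on. -/
def phase : Prog :=
  .setI 10 (.const 1) ;; .while (.ieq (.reg 10) (.const 1)) phaseBody

theorem phaseBody_runs {s : State} {Q : ℕ → ℝ × ℝ} {S : Set ℕ} {k : ℕ} (hS : S.Finite)
    (hs : Setup s Q S k) (hv : s.ireg 7 ∈ S) (hvl : IsLower Q S (Q (s.ireg 7))) :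
    Runs phaseBody s (findNextCost k (s.ireg 6) + phaseBody.cost) fun s' => Agree s s' ∧
      ((∀ e ∈ S, toLex (Q (s.ireg 7)) ≤ toLex (Q e)) ∧ s'.ireg 10 = 0 ∧ s'.ireg 7 = s.ireg 7 ∧
          s'.ireg 9 = s.ireg 9 ∧ s'.iarr outArr = s.iarr outArr ∨
        IsNext Q S (s.ireg 7) (s'.ireg 7) ∧ s'.ireg 10 = s.ireg 10 ∧
          s'.ireg 9 = s.ireg 9 + 1 ∧ s'.iarr outArr =
            Function.update (s.iarr outArr) (s.ireg 9) (s'.ireg 7)) := by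
  refine Runs.mono (Runs.seq (findNext_runs hs hv hvl) fun s₁ h₁ =>
    Prog.runs_of_wp _ _ _ ?_) (by simp only [phaseBody, Prog.cost]; omega) fun _ h => h
  obtain ⟨K, hb1, hb2⟩ := h₁
  -- Any event to the left of `v` forces the flag to be 1 and the recorded event to be a successor.
  -- A flag 0 therefore certifies that `v` is smallest.
  have hnext : ∀ y ∈ S, toLex (Q y) < toLex (Q (s.ireg 7)) → s₁.ireg 12 = 1 ∧
      IsNext Q S (s.ireg 7) (s₁.ireg 13) := by
    intro y hy hyv
    obtain ⟨u, hu⟩ := exists_isNext hS hy hyv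
    obtain ⟨h1, h2⟩ := hb2 u hu trivial
    rcases hb1 with h0 | ⟨-, hbS, -⟩
    · omega
    · exact ⟨h1, hbS, h2 ▸ hu.lt, fun x hx hxv => h2 ▸ hu.dom x hx hxv⟩
  simp only [Prog.wp, BExp.holds, IExp.val]
  refine ⟨fun h0 => ⟨⟨fun a _ => by rw [K.iarr], K.rarr, K.rreg, fun r hr => ?_⟩,
    .inl ⟨fun e he => ?_, ?_⟩⟩, fun h0 => ⟨⟨fun a ha => ?_, K.rarr, K.rreg, fun r hr => ?_⟩,
    .inr ?_⟩⟩
  · exact (Function.update_of_ne (by omega) _ _).trans (K.ireg r (by omega))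
  · by_contra! hc
    have := (hnext e he hc).1
    omega
  · simp [K.iarr, K.ireg]
  · exact (Function.update_of_ne ha _ _).trans (by rw [K.iarr])
  · simp only [Function.update_apply]
    rw [if_neg (by omega), if_neg (by omega)]
    exact K.ireg r (by omega)
  · obtain ⟨-, hbS, hbv⟩ := hb1.resolve_left h0
    have := (hnext _ hbS hbv).2
    simp [this, K.iarr, K.ireg]

theorem phase_runs {s : State} {Q : ℕ → ℝ × ℝ} {S : Set ℕ} {k h : ℕ} {L : List ℕ}
    (hS : S.Finite) (hs : Setup s Q S k) (hv : s.ireg 7 ∈ S)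
    (hmax : ∀ e ∈ S, toLex (Q e) ≤ toLex (Q (s.ireg 7))) (hL : Out s L)
    (hh : ∀ D : List ℕ, (D.Pairwise fun a b => toLex (Q b) < toLex (Q a)) →
      (∀ e ∈ D, e ∈ S ∧ IsLower Q S (Q e)) → D.length ≤ h) :
    Runs phase s (2 + (h + 1) * (findNextCost k (s.ireg 6) + phaseBody.cost + 4)) fun s' =>
      Agree s s' ∧ ∃ D, Out s' (L ++ D) ∧ LowerPrefix Q S (s.ireg 7 :: D) (s'.ireg 7) ∧
        ∀ e ∈ S, toLex (Q (s'.ireg 7)) ≤ toLex (Q e) := by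
  refine Runs.seq (T₁ := 2) (R₁ := fun s' => Keeps 10 s s' ∧ s'.ireg 10 = 1)
    (Prog.runs_of_wp _ _ _ ⟨⟨rfl, rfl, rfl, fun r hr => ?_⟩, ?_⟩) fun s₁ h₁ => ?_
  · exact Function.update_of_ne (by omega) _ _
  · simp [IExp.val]
  obtain ⟨K, e10⟩ := h₁
  have hA : Agree s s₁ :=
    ⟨fun a _ => by rw [K.iarr], K.rarr, K.rreg, fun r hr => K.ireg r (by omega)⟩
  refine Runs.while (T := findNextCost k (s.ireg 6) + phaseBody.cost) (fun f s' => Agree s s' ∧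
    ∃ D, Out s' (L ++ D) ∧ LowerPrefix Q S (s.ireg 7 :: D) (s'.ireg 7) ∧
      (s'.ireg 10 = 1 ∧ D.length + f = h ∨ s'.ireg 10 = 0 ∧
        ∀ e ∈ S, toLex (Q (s'.ireg 7)) ≤ toLex (Q e))) ?_ ?_ h s₁
    ⟨hA, [], ?_, ?_, .inl ⟨e10, by simp⟩⟩
  · rintro f s' ⟨hA, D, hO, hD, hc⟩ hb
    have hb : s'.ireg 10 = 1 := hb
    obtain ⟨-, hf⟩ := hc.resolve_right fun h => by omega
    -- The list includes the starting vertex, so `D.length + 1 ≤ h`. This leaves one iteration for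
    -- the last, unsuccessful search.
    have hlen := hh _ hD.sorted hD.mem
    simp only [List.length_cons] at hlen
    obtain ⟨f, rfl⟩ : ∃ f', f = f' + 1 := ⟨f - 1, by omega⟩
    have hm := hD.mem _ hD.last_mem
    have hrun := phaseBody_runs hS (hs.agree hA) hm.1 hm.2
    rw [hA.ireg 6 (by omega)] at hrun
    refine ⟨f, rfl, hrun.mono le_rfl ?_⟩
    rintro s'' ⟨hA', ⟨hmin, h10, h7, h9, ho⟩ | ⟨hn, h10, h9, ho⟩⟩
    · refine ⟨hA.trans hA', D, ⟨h9.trans hO.1, fun m hm => ?_⟩, ?_, .inr ⟨h10, ?_⟩⟩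
      · rw [ho]
        exact hO.2 m hm
      · rw [h7]
        exact hD
      · rw [h7]
        exact hmin
    · refine ⟨hA.trans hA', D ++ [s''.ireg 7], ⟨?_, fun m hm => ?_⟩, hD.append hn,
        .inl ⟨h10.trans hb, by simp only [List.length_append, List.length_singleton]; omega⟩⟩
      · rw [h9, hO.1]
        simp only [List.length_append, List.length_singleton]
        omega
      · rw [ho, hO.1]
        simp only [← List.append_assoc] at hm ⊢
        rcases Nat.lt_or_ge m (L ++ D).length with hlt | hge
        · rw [Function.update_of_ne (by omega), List.getElem_append_left hlt]
          exact hO.2 m hlt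
        · rw [List.length_append, List.length_singleton] at hm
          obtain rfl : m = (L ++ D).length := by omega
          simp
  · rintro f s' ⟨hA, D, hO, hD, hc⟩ hb
    have hb : ¬ s'.ireg 10 = 1 := hb
    exact ⟨hA, D, hO, hD, (hc.resolve_left fun h => hb h.1).2⟩
  · rw [List.append_nil]
    refine ⟨(K.ireg 9 (by omega)).trans hL.1, fun m hm => ?_⟩
    rw [K.iarr]
    exact hL.2 m hm
  · rw [K.ireg 7 (by omega)]
    exact .singleton hv hmax

/-! ### The nodes whose canonical subsets form the window -/

theorem mem_canonicalSet {n ℓ k e : ℕ} : e ∈ canonicalSet n ℓ k ↔ e / 2 ^ ℓ = k ∧ e < n := by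
  induction ℓ generalizing k with
  | zero => simp [canonicalSet]
  | succ ℓ ih =>
    rw [canonicalSet, Set.mem_union, ih, ih, pow_succ, ← Nat.div_div_eq_div_mul]
    omega

/-- The whole block of `2 ^ ℓ` indices below `k` lies in the window, hence below `n`. So the climb
only meets full nodes, never the incomplete right border of the tree. -/
theorem isNode_of_forall {n ℓ i j l r k : ℕ}
    (h : ∀ e, l ≤ e / 2 ^ ℓ → e / 2 ^ ℓ ≤ r → i ≤ e ∧ e ≤ j) (hj : j < n) (hlk : l ≤ k)
    (hkr : k ≤ r) : IsNode n ℓ k := by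
  have hpos : 0 < 2 ^ ℓ := by positivity
  have h1 : k * 2 ^ ℓ / 2 ^ ℓ = k := Nat.mul_div_cancel _ hpos
  have h2 : (k * 2 ^ ℓ + (2 ^ ℓ - 1)) / 2 ^ ℓ = k := by
    rw [Nat.mul_comm, Nat.mul_add_div hpos, Nat.div_eq_of_lt (by omega), Nat.add_zero]
  have h3 := h _ (by rw [h1]; exact hlk) (by rw [h1]; exact hkr)
  have h4 := h _ (by rw [h2]; exact hlk) (by rw [h2]; exact hkr)
  refine ⟨?_, by omega⟩
  have : 2 ^ ℓ ≤ 2 ^ Nat.clog 2 n := le_trans (by omega) (Nat.le_pow_clog (by omega) n)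
  exact (Nat.pow_le_pow_iff_right (by omega)).1 this

/-- The address `a` is that of a node whose canonical subset lies in the window and contains the
events with the property `M`. -/
def IsWindowNode (n : ℕ) (addr : ℕ → ℕ → ℕ) (i j a : ℕ) (M : ℕ → Prop) : Prop :=
  ∃ ℓ k, IsNode n ℓ k ∧ a = addr ℓ k ∧ canonicalSet n ℓ k ⊆ Set.Icc i j ∧
    ∀ e, M e → e ∈ canonicalSet n ℓ k

/-- The first `c` cells of the array `A` hold addresses of nodes whose canonical subsets lie in
the window and cover all of it, except possibly for events with the property `M`. -/
structure Collected (n : ℕ) (addr : ℕ → ℕ → ℕ) (i j : ℕ) (A : ℕ → ℕ) (c : ℕ) (M : ℕ → Prop) :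
    Prop where
  node : ∀ m < c, IsWindowNode n addr i j (A m) fun _ => False
  cover : ∀ e, i ≤ e → e ≤ j → M e ∨ ∃ m < c, IsWindowNode n addr i j (A m) fun x => x = e

theorem Collected.push {n : ℕ} {addr : ℕ → ℕ → ℕ} {i j : ℕ} {A : ℕ → ℕ} {c l r l' r' ℓ k : ℕ}
    (h : Collected n addr i j A c fun e => l ≤ e / 2 ^ ℓ ∧ e / 2 ^ ℓ ≤ r)
    (hr : ∀ e, l ≤ e / 2 ^ ℓ → e / 2 ^ ℓ ≤ r → i ≤ e ∧ e ≤ j) (hj : j < n) (hlk : l ≤ k)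
    (hkr : k ≤ r) (hk : ∀ x, l ≤ x → x ≤ r → x ≠ k → l' ≤ x ∧ x ≤ r') :
    Collected n addr i j (Function.update A c (addr ℓ k)) (c + 1)
      fun e => l' ≤ e / 2 ^ ℓ ∧ e / 2 ^ ℓ ≤ r' := by
  have hnode := isNode_of_forall hr hj hlk hkr
  have hsub : canonicalSet n ℓ k ⊆ Set.Icc i j := by
    intro e he
    obtain ⟨rfl, -⟩ := mem_canonicalSet.1 he
    exact hr e hlk hkr
  have hold : ∀ m < c, Function.update A c (addr ℓ k) m = A m := fun m hm =>
    Function.update_of_ne (by omega) _ _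
  refine ⟨fun m hm => ?_, fun e he he' => ?_⟩
  · rcases Nat.lt_or_ge m c with hlt | hge
    · rw [hold m hlt]
      exact h.node m hlt
    · obtain rfl : m = c := by omega
      rw [Function.update_self]
      exact ⟨ℓ, k, hnode, rfl, hsub, by simp⟩
  · rcases h.cover e he he' with ⟨h1, h2⟩ | ⟨m, hm, hw⟩
    · by_cases hek : e / 2 ^ ℓ = k
      · refine .inr ⟨c, by omega, ?_⟩
        rw [Function.update_self]
        refine ⟨ℓ, k, hnode, rfl, hsub, ?_⟩
        rintro x rfl
        exact mem_canonicalSet.2 ⟨hek, by omega⟩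
      · exact .inl (hk _ h1 h2 hek)
    · refine .inr ⟨m, by omega, ?_⟩
      rw [hold m hm]
      exact hw

theorem Collected.mono {n : ℕ} {addr : ℕ → ℕ → ℕ} {i j : ℕ} {A : ℕ → ℕ} {c : ℕ}
    {M M' : ℕ → Prop} (h : Collected n addr i j A c M) (hM : ∀ e, M e → M' e) :
    Collected n addr i j A c M' :=
  ⟨h.node, fun e he he' => (h.cover e he he').imp_left (hM e)⟩

/-- Test whether a number is even. -/
def isEven (e : IExp) : BExp := .ieq (.add (.half e) (.half e)) e

theorem isEven_holds {e : IExp} {s : State} : (isEven e).holds s ↔ e.val s % 2 = 0 := by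
  simp only [isEven, BExp.holds, IExp.val]
  omega

/-- Take the leftmost node if it is a right child. -/
def takeLeft : Prog :=
  .ite (isEven (.reg 4)) .skip
    (.storeI nodeArr (.reg 6) (.reg 2) ;; .setI 6 (.add (.reg 6) (.const 1)) ;;
      .setI 2 (.load nextArr (.reg 2)) ;; .setI 4 (.add (.reg 4) (.const 1)))

/-- Take the rightmost node if it is a left child. -/
def takeRight : Prog :=
  .ite (isEven (.reg 5))
    (.storeI nodeArr (.reg 6) (.reg 3) ;; .setI 6 (.add (.reg 6) (.const 1)) ;;
      .setI 3 (.load prevArr (.reg 3)) ;; .setI 5 (.sub (.reg 5) (.const 1)))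
    .skip

/-- Go up to the next level. -/
def goUp : Prog :=
  .setI 2 (.load parentArr (.reg 2)) ;; .setI 3 (.load parentArr (.reg 3)) ;;
  .setI 4 (.half (.reg 4)) ;; .setI 5 (.half (.reg 5))

/-- Collect the addresses of the nodes whose canonical subsets form the window. -/
def collect : Prog :=
  (.setI 2 (.load leafArr (.reg 0)) ;; .setI 3 (.load leafArr (.reg 1)) ;; .setI 4 (.reg 0) ;;
    .setI 5 (.reg 1) ;; .setI 6 (.const 0)) ;;
  .while (.ilt (.reg 4) (.reg 5)) (takeLeft ;; takeRight ;; goUp) ;;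
  .ite (.ieq (.reg 4) (.reg 5))
    (.storeI nodeArr (.reg 6) (.reg 2) ;; .setI 6 (.add (.reg 6) (.const 1))) .skip

/-- The events at the nodes `s.ireg 4, …, s.ireg 5` on level `ℓ` remain to be covered. -/
structure CollectInv (s₀ : State) (n : ℕ) (addr : ℕ → ℕ → ℕ) (i j ℓ : ℕ) (s : State) :
    Prop where
  iarr : ∀ a ≠ nodeArr, s.iarr a = s₀.iarr a
  rarr : s.rarr = s₀.rarr
  rreg : s.rreg = s₀.rreg
  ireg : ∀ r < 2, s.ireg r = s₀.ireg r
  range : ∀ e, s.ireg 4 ≤ e / 2 ^ ℓ → e / 2 ^ ℓ ≤ s.ireg 5 → i ≤ e ∧ e ≤ j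
  left : s.ireg 4 ≤ s.ireg 5 → s.ireg 2 = addr ℓ (s.ireg 4)
  right : s.ireg 4 ≤ s.ireg 5 → s.ireg 3 = addr ℓ (s.ireg 5)
  collected : Collected n addr i j (s.iarr nodeArr) (s.ireg 6)
    fun e => s.ireg 4 ≤ e / 2 ^ ℓ ∧ e / 2 ^ ℓ ≤ s.ireg 5

section Collect

variable {s₀ s : State} {n : ℕ} {p : ℕ → ℝ × ℝ} {addr : ℕ → ℕ → ℕ} {i j ℓ : ℕ}

theorem CollectInv.isNode (h : CollectInv s₀ n addr i j ℓ s) (hj : j < n) {k : ℕ}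
    (hk : s.ireg 4 ≤ k) (hk' : k ≤ s.ireg 5) : IsNode n ℓ k :=
  isNode_of_forall h.range hj hk hk'

theorem takeLeft_runs (hs₀ : StoresDecomposition s₀ n p addr) (hj : j < n)
    (h : CollectInv s₀ n addr i j ℓ s) (hlt : s.ireg 4 < s.ireg 5) :
    Runs takeLeft s takeLeft.cost fun s' => CollectInv s₀ n addr i j ℓ s' ∧
      s'.ireg 5 = s.ireg 5 ∧ s'.ireg 6 ≤ s.ireg 6 + 1 ∧ s'.ireg 4 % 2 = 0 ∧
      s.ireg 4 ≤ s'.ireg 4 ∧ s'.ireg 4 ≤ s.ireg 4 + 1 := by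
  apply Prog.runs_of_wp
  simp only [takeLeft, Prog.wp, isEven_holds, IExp.val]
  refine ⟨fun he => ⟨h, trivial, by omega, he, le_rfl, by omega⟩, fun ho => ?_⟩
  refine ⟨⟨fun a ha => ?_, h.rarr, h.rreg, fun r hr => ?_, ?_, ?_, ?_, ?_⟩, ?_⟩
  · exact (Function.update_of_ne ha _ _).trans (h.iarr a ha)
  · simp only [Function.update_apply]
    rw [if_neg (by omega), if_neg (by omega), if_neg (by omega)]
    exact h.ireg r hr
  · simp
    exact fun e he he' => h.range e (by omega) he'
  · intro _
    simp
    rw [h.iarr _ (by decide), h.left hlt.le]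
    exact hs₀.next _ _ (h.isNode hj le_rfl hlt.le) (h.isNode hj (by omega) hlt)
  · intro _
    simp
    exact h.right hlt.le
  · simp
    rw [h.left hlt.le]
    exact h.collected.push h.range hj le_rfl hlt.le fun x hx hx' hne => by omega
  · simp
    omega

theorem takeRight_runs (hs₀ : StoresDecomposition s₀ n p addr) (hj : j < n)
    (h : CollectInv s₀ n addr i j ℓ s) (hle : s.ireg 4 ≤ s.ireg 5) (hpos : 0 < s.ireg 5) :
    Runs takeRight s takeRight.cost fun s' => CollectInv s₀ n addr i j ℓ s' ∧
      s'.ireg 4 = s.ireg 4 ∧ s'.ireg 6 ≤ s.ireg 6 + 1 ∧ s'.ireg 5 % 2 = 1 ∧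
      s'.ireg 5 ≤ s.ireg 5 ∧ s.ireg 5 ≤ s'.ireg 5 + 1 := by
  apply Prog.runs_of_wp
  simp only [takeRight, Prog.wp, isEven_holds, IExp.val]
  refine ⟨fun he => ?_, fun ho => ⟨h, trivial, by omega, by omega, le_rfl, by omega⟩⟩
  refine ⟨⟨fun a ha => ?_, h.rarr, h.rreg, fun r hr => ?_, ?_, ?_, ?_, ?_⟩, ?_⟩
  · exact (Function.update_of_ne ha _ _).trans (h.iarr a ha)
  · simp only [Function.update_apply]
    rw [if_neg (by omega), if_neg (by omega), if_neg (by omega)]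
    exact h.ireg r hr
  · simp
    exact fun e he he' => h.range e he (by omega)
  · intro _
    simp
    exact h.left hle
  · simp
    intro hlt
    rw [h.iarr _ (by decide), h.right hle]
    have := hs₀.prev ℓ (s.ireg 5 - 1) (h.isNode hj (by omega) (by omega))
      (h.isNode hj (by omega) (by omega))
    -- Positivity of register 5 is needed because subtraction is truncated.
    rwa [Nat.sub_add_cancel hpos] at this
  · simp
    rw [h.right hle]
    exact h.collected.push h.range hj hle le_rfl fun x hx hx' hne => by omega
  · simp
    omega

/-- An even left and an odd right end mean that the remaining nodes are complete pairs of siblings,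
so halving both ends keeps exactly the same events. An empty range, whose ends have crossed, stays
empty. -/
theorem goUp_runs (hs₀ : StoresDecomposition s₀ n p addr) (hj : j < n)
    (h : CollectInv s₀ n addr i j ℓ s) (h4 : s.ireg 4 % 2 = 0) (h5 : s.ireg 5 % 2 = 1) :
    Runs goUp s goUp.cost fun s' => CollectInv s₀ n addr i j (ℓ + 1) s' ∧
      s'.ireg 4 = s.ireg 4 / 2 ∧ s'.ireg 5 = s.ireg 5 / 2 ∧ s'.ireg 6 = s.ireg 6 := by
  apply Prog.runs_of_wp
  simp only [goUp, Prog.wp, IExp.val]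
  have hdiv : ∀ e, e / 2 ^ (ℓ + 1) = e / 2 ^ ℓ / 2 := fun e => by
    rw [pow_succ, Nat.div_div_eq_div_mul]
  have hrange : ∀ e, s.ireg 4 / 2 ≤ e / 2 ^ (ℓ + 1) → e / 2 ^ (ℓ + 1) ≤ s.ireg 5 / 2 →
      i ≤ e ∧ e ≤ j := by
    intro e he he'
    rw [hdiv] at he he'
    exact h.range e (by omega) (by omega)
  refine ⟨⟨h.iarr, h.rarr, h.rreg, fun r hr => ?_, ?_, ?_, ?_, ?_⟩, ?_⟩
  · simp only [Function.update_apply]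
    rw [if_neg (by omega), if_neg (by omega), if_neg (by omega), if_neg (by omega)]
    exact h.ireg r hr
  · simp
    exact hrange
  · simp
    intro hle
    rw [h.iarr _ (by decide), h.left (by omega)]
    exact hs₀.parent _ _ (h.isNode hj le_rfl (by omega)) (isNode_of_forall hrange hj le_rfl hle)
  · simp
    intro hle
    rw [h.iarr _ (by decide), h.right (by omega)]
    exact hs₀.parent _ _ (h.isNode hj (by omega) le_rfl) (isNode_of_forall hrange hj hle le_rfl)
  · simp
    exact h.collected.mono fun e he => by rw [hdiv]; omega
  · simp

theorem collect_runs (hs₀ : StoresDecomposition s₀ n p addr) (hij : i ≤ j) (hj : j < n)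
    (h0 : s₀.ireg 0 = i) (h1 : s₀.ireg 1 = j) {k : ℕ} (hk : j - i < 2 ^ k) :
    Runs collect s₀ (collect.cost + (k + 1) * (takeLeft.cost + (takeRight.cost + goUp.cost) + 4))
      fun s => (∀ a ≠ nodeArr, s.iarr a = s₀.iarr a) ∧ s.rarr = s₀.rarr ∧ s.rreg = s₀.rreg ∧
        (∀ r < 2, s.ireg r = s₀.ireg r) ∧ s.ireg 6 ≤ 2 * k + 1 ∧
        Collected n addr i j (s.iarr nodeArr) (s.ireg 6) fun _ => False := by
  refine Runs.mono (T := Prog.cost (.setI 2 (.load leafArr (.reg 0)) ;;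
    .setI 3 (.load leafArr (.reg 1)) ;; .setI 4 (.reg 0) ;;
    .setI 5 (.reg 1) ;; .setI 6 (.const 0)) +
    ((k + 1) * (takeLeft.cost + (takeRight.cost + goUp.cost) + 4) +
      Prog.cost (.ite (.ieq (.reg 4) (.reg 5))
    (.storeI nodeArr (.reg 6) (.reg 2) ;; .setI 6 (.add (.reg 6) (.const 1))) .skip))) ?_
    (by simp only [collect, Prog.cost, IExp.cost, BExp.cost]; omega) fun _ h => h
  refine Runs.seq (R₁ := fun s => CollectInv s₀ n addr i j 0 s ∧ s.ireg 4 = i ∧ s.ireg 5 = j ∧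
    s.ireg 6 = 0) (Prog.runs_of_wp _ _ _ ?_) fun s₁ hs₁ => ?_
  · simp only [Prog.wp, IExp.val]
    refine ⟨⟨fun a _ => rfl, rfl, rfl, fun r hr => ?_, ?_, ?_, ?_, ?_⟩, ?_⟩
    · simp only [Function.update_apply]
      rw [if_neg (by omega), if_neg (by omega), if_neg (by omega), if_neg (by omega),
        if_neg (by omega)]
    · simpa [h0, h1] using fun e a b => ⟨a, b⟩
    · simp [h0, hs₀.leaf i (by omega)]
    · simp [h1, hs₀.leaf j hj]
    · simp only [Function.update_apply]
      exact ⟨fun m hm => by simp at hm, fun e he he' => .inl (by simp [h0, h1, he, he'])⟩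
    · simp [h0, h1]
  · obtain ⟨hI, e4, e5, e6⟩ := hs₁
    refine Runs.seq (Runs.while (T := takeLeft.cost + (takeRight.cost + goUp.cost))
      (R := fun s => ∃ ℓ, CollectInv s₀ n addr i j ℓ s ∧ s.ireg 6 ≤ 2 * k ∧
        ¬ s.ireg 4 < s.ireg 5)
      (fun f s => ∃ ℓ, CollectInv s₀ n addr i j ℓ s ∧ s.ireg 6 + 2 * f ≤ 2 * k ∧
        s.ireg 5 - s.ireg 4 < 2 ^ f) ?_ ?_ k s₁ ⟨0, hI, by omega, by rwa [e4, e5]⟩) ?_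
    · rintro f s ⟨ℓ, hI, hf, hd⟩ hb
      have hb : s.ireg 4 < s.ireg 5 := hb
      obtain _ | f := f
      · omega
      rw [pow_succ] at hd
      refine ⟨f, rfl, Runs.seq (takeLeft_runs hs₀ hj hI hb) ?_⟩
      rintro s' ⟨hI', a1, a2, a3, a4, a5⟩
      refine Runs.seq (takeRight_runs hs₀ hj hI' (by omega) (by omega)) ?_
      rintro s'' ⟨hI'', b1, b2, b3, b4, b5⟩
      refine (goUp_runs hs₀ hj hI'' (by omega) b3).mono le_rfl ?_
      rintro s3 ⟨hI3, c1, c2, c3⟩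
      -- At most two nodes were added. From an even left end to an odd right end the distance is
      -- odd, so rounding makes the new distance less than half of the old one, hence below `2 ^ f`.
      exact ⟨ℓ + 1, hI3, by omega, by omega⟩
    · rintro f s ⟨ℓ, hI, hf, hd⟩ hb
      exact ⟨ℓ, hI, by omega, hb⟩
    · rintro s ⟨ℓ, hI, h6, hb⟩
      refine Prog.runs_of_wp _ _ _ ?_
      simp only [Prog.wp, BExp.holds, IExp.val]
      refine ⟨fun he => ⟨fun a ha => ?_, hI.rarr, hI.rreg, fun r hr => ?_, ?_, ?_⟩,
        fun hne => ⟨hI.iarr, hI.rarr, hI.rreg, hI.ireg, by omega,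
          hI.collected.mono fun e he => by omega⟩⟩
      · exact (Function.update_of_ne ha _ _).trans (hI.iarr a ha)
      · exact (Function.update_of_ne (by omega) _ _).trans (hI.ireg r hr)
      · simp
        omega
      · simp
        rw [hI.left he.le]
        -- The bounds 1 and 0 encode that no events remain.
        exact (hI.collected.push (l' := 1) (r' := 0) hI.range hj le_rfl he.le
          fun x hx hx' hne => by omega).mono fun e he => by omega

end Collect

/-! ### The lexicographically largest event -/

/-- Compare the first hull vertex of a node with the largest event so far. -/
def largestBody : Prog :=
  .setI 17 (ev (.load hullPosArr (.load nodeArr (.reg 11)))) ;;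
  .ite (lexLt (.reg 7) (.reg 17)) (.setI 7 (.reg 17)) .skip ;;
  .setI 11 (.add (.reg 11) (.const 1))

/-- Find the lexicographically largest event of the window. -/
def largest : Prog :=
  (.setI 7 (.reg 0) ;; .setI 11 (.const 0)) ;; .while (.ilt (.reg 11) (.reg 6)) largestBody

theorem largestBody_runs {s : State} {Q : ℕ → ℝ × ℝ} {S : Set ℕ} (hco : Coord s Q S)
    (h7 : s.ireg 7 ∈ S) (hf : s.iarr hullEventArr (hullPos s (s.ireg 11)) ∈ S) :
    Runs largestBody s largestBody.cost fun s' => Keeps 7 s s' ∧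
      s'.ireg 11 = s.ireg 11 + 1 ∧ s'.ireg 7 ∈ S ∧
      toLex (Q (s.ireg 7)) ≤ toLex (Q (s'.ireg 7)) ∧
      toLex (Q (s.iarr hullEventArr (hullPos s (s.ireg 11)))) ≤ toLex (Q (s'.ireg 7)) := by
  apply Prog.runs_of_wp
  change Prog.wp (.seq (.ite _ _ _) _) _ { s with ireg := Function.update s.ireg 17 _ }
  generalize hs1 : ({ s with ireg := Function.update s.ireg 17 _ } : State) = s1
  have hco1 : Coord s1 Q S := by rw [← hs1]; exact hco
  have e7 : s1.ireg 7 = s.ireg 7 := by simp [← hs1]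
  have e11 : s1.ireg 11 = s.ireg 11 := by simp [← hs1]
  have e17 : s1.ireg 17 = s.iarr hullEventArr (hullPos s (s.ireg 11)) := by
    simp [← hs1, ev, IExp.val, hullPos]
  have K : Keeps 7 s s1 := by
    rw [← hs1]
    exact ⟨rfl, rfl, rfl, fun r hr => Function.update_of_ne (by omega) _ _⟩
  simp only [Prog.wp]
  rw [hco1.lexLt_holds (by simpa [IExp.val, e7]) (by simpa [IExp.val, e17])]
  simp only [IExp.val]
  rw [← e17] at hf ⊢
  refine ⟨fun hlt => ⟨⟨K.iarr, K.rarr, K.rreg, fun r hr => ?_⟩, ?_, ?_, ?_, ?_⟩,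
    fun hge => ⟨⟨K.iarr, K.rarr, K.rreg, fun r hr => ?_⟩, ?_, ?_, ?_, ?_⟩⟩
  · simp only [Function.update_apply]
    rw [if_neg (by omega), if_neg (by omega)]
    exact K.ireg r hr
  · simp [e11]
  · simpa using hf
  · rw [← e7]
    simpa using hlt.le
  · simp
  · exact (Function.update_of_ne (by omega) _ _).trans (K.ireg r hr)
  · simp [e11]
  · simpa [e7] using h7
  · simp [e7]
  · simpa using hge

theorem largest_runs {s : State} {Q : ℕ → ℝ × ℝ} {S : Set ℕ} (hco : Coord s Q S)
    (h0 : s.ireg 0 ∈ S) (hf : ∀ m < s.ireg 6, s.iarr hullEventArr (hullPos s m) ∈ S)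
    (hc : ∀ e ∈ S, ∃ m < s.ireg 6,
      toLex (Q e) ≤ toLex (Q (s.iarr hullEventArr (hullPos s m)))) :
    Runs largest s (4 + (s.ireg 6 + 1) * (largestBody.cost + 4)) fun s' => Keeps 7 s s' ∧
      s'.ireg 7 ∈ S ∧ ∀ e ∈ S, toLex (Q e) ≤ toLex (Q (s'.ireg 7)) := by
  refine Runs.seq (T₁ := 4) (R₁ := fun s' => Keeps 7 s s' ∧ s'.ireg 11 = 0 ∧
    s'.ireg 7 = s.ireg 0)
    (Prog.runs_of_wp _ _ _ ⟨⟨rfl, rfl, rfl, fun r hr => ?_⟩, ?_, ?_⟩) fun s₁ h₁ => ?_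
  · simp only [Function.update_apply]
    rw [if_neg (by omega), if_neg (by omega)]
  · simp [IExp.val]
  · simp [IExp.val]
  obtain ⟨K₁, e11, e7⟩ := h₁
  refine Runs.while (T := largestBody.cost) (fun f s' => Keeps 7 s s' ∧
    s'.ireg 11 + f = s.ireg 6 ∧ s'.ireg 7 ∈ S ∧ ∀ m < s'.ireg 11,
      toLex (Q (s.iarr hullEventArr (hullPos s m))) ≤ toLex (Q (s'.ireg 7))) ?_ ?_ _ s₁
    ⟨K₁, by omega, by rwa [e7], fun m hm => by omega⟩
  · rintro f s' ⟨K, hfu, h7, hm⟩ hb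
    have hb : s'.ireg 11 < s'.ireg 6 := hb
    rw [K.ireg 6 (by omega)] at hb
    have hpos : ∀ m, hullPos s' m = hullPos s m := fun m => by rw [hullPos, K.iarr, hullPos]
    obtain ⟨f, rfl⟩ : ∃ f', f = f' + 1 := ⟨f - 1, by omega⟩
    refine ⟨f, rfl, (largestBody_runs (hco.keeps K) h7
      (by rw [hpos, K.iarr]; exact hf _ hb)).mono le_rfl ?_⟩
    rintro s'' ⟨K', a1, a2, a3, a4⟩
    refine ⟨K.trans K' le_rfl, by omega, a2, fun m hm' => ?_⟩
    rcases Nat.lt_or_ge m (s'.ireg 11) with h | h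
    · exact (hm m h).trans a3
    · obtain rfl : m = s'.ireg 11 := by omega
      rwa [hpos, K.iarr] at a4
  · rintro f s' ⟨K, hfu, h7, hm⟩ hb
    have hb : ¬ s'.ireg 11 < s'.ireg 6 := hb
    rw [K.ireg 6 (by omega)] at hb
    refine ⟨K, h7, fun e he => ?_⟩
    obtain ⟨m, hm', hle⟩ := hc e he
    exact hle.trans (hm m (by omega))

/-! ### The program -/

/-- The hull of the events in `S'` is stored at the `m`-th node of the window. -/
def StoredNode (s : State) (p : ℕ → ℝ × ℝ) (S' : Set ℕ) (m : ℕ) : Prop :=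
  ∃ L : List ℕ, IsHullList p S' L ∧ s.iarr hullLenArr (s.iarr nodeArr m) = L.length ∧
    (∀ (x : ℕ) (hx : x < L.length), s.iarr hullEventArr (hullPos s m + x) = L[x]) ∧
    s.iarr hullMinArr (s.iarr nodeArr m) < L.length ∧
    ∀ e ∈ S', toLex (p (s.iarr hullEventArr (hullPos s m +
      s.iarr hullMinArr (s.iarr nodeArr m)))) ≤ toLex (p e)

/-- The nodes in `nodeArr` store hulls of parts of `S` that cover `S`. -/
structure StoredCover (s : State) (p : ℕ → ℝ × ℝ) (S : Set ℕ) : Prop where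
  node : ∀ m < s.ireg 6, ∃ S' ⊆ S, StoredNode s p S' m
  cover : ∀ e ∈ S, ∃ m < s.ireg 6, ∃ S' ⊆ S, e ∈ S' ∧ StoredNode s p S' m

theorem Collected.storedCover {s₀ s : State} {n : ℕ} {p : ℕ → ℝ × ℝ} {addr : ℕ → ℕ → ℕ}
    {i j : ℕ} (hs₀ : StoresDecomposition s₀ n p addr)
    (h : Collected n addr i j (s.iarr nodeArr) (s.ireg 6) fun _ => False)
    (ha : ∀ a ≠ nodeArr, s.iarr a = s₀.iarr a) : StoredCover s p (Set.Icc i j) := by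
  have key : ∀ m ℓ k, IsNode n ℓ k → s.iarr nodeArr m = addr ℓ k →
      StoredNode s p (canonicalSet n ℓ k) m := by
    intro m ℓ k hk hm
    obtain ⟨L, hL, hlen, hE, hmin, hle⟩ := hs₀.hull ℓ k hk
    unfold StoredNode hullPos
    rw [hm, ha hullLenArr (by decide), ha hullPosArr (by decide), ha hullMinArr (by decide),
      ha hullEventArr (by decide)]
    refine ⟨L, hL, hlen, hE, hmin, fun e he => ?_⟩
    rw [hE _ hmin, ← lexLE_iff]
    exact hle e he
  refine ⟨fun m hm => ?_, fun e he => ?_⟩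
  · obtain ⟨ℓ, k, hk, ha, hsub, -⟩ := h.node m hm
    exact ⟨_, hsub, key m ℓ k hk ha⟩
  · obtain ⟨m, hm, ℓ, k, hk, ha, hsub, hM⟩ := (h.cover e he.1 he.2).resolve_left id
    exact ⟨m, hm, _, hsub, hM e rfl, key m ℓ k hk ha⟩

theorem IsChain.mono {Q : ℕ → ℝ × ℝ} {S S' : Set ℕ} {c : ℕ → ℕ} {lo hi : ℕ}
    (h : IsChain Q S' c lo hi) (hS : S' ⊆ S) : IsChain Q S c lo hi :=
  ⟨h.le, fun a ha ha' => hS (h.mem a ha ha'), h.lt, h.convex⟩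

section Stored

variable {s : State} {p : ℕ → ℝ × ℝ} {S : Set ℕ} {k : ℕ}

theorem StoredCover.first_mem (h : StoredCover s p S) {m : ℕ} (hm : m < s.ireg 6) :
    s.iarr hullEventArr (hullPos s m) ∈ S := by
  obtain ⟨S', hS', L, hL, hlen, hE, hμ, hmin⟩ := h.node m hm
  exact hS' (hL.stored_mem hE (show 0 < L.length by omega))

theorem StoredCover.exists_le_first (h : StoredCover s p S) {e : ℕ} (he : e ∈ S) :
    ∃ m < s.ireg 6, toLex (p e) ≤ toLex (p (s.iarr hullEventArr (hullPos s m))) := by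
  obtain ⟨m, hm, S', hS', heS', L, hL, hlen, hE, hμ, hmin⟩ := h.cover e he
  exact ⟨m, hm, hL.stored_zero hE hμ heS'⟩

/-- A stored list has no repetitions and consists of events of the window, so every chain has fewer
than `2 ^ k` edges. A lower vertex of `S` is a lower vertex of each part containing it, which gives
the cover by candidates. -/
theorem StoredCover.setup (h : StoredCover s p S) (hS : S.Finite) (hk : S.ncard < 2 ^ k)
    (hco : Coord s p S) (h5 : s.ireg 5 = 0) : Setup s p S k := by
  refine ⟨hco, fun m hm => ?_, fun m hm => ?_, fun m hm => h.first_mem hm, fun u hu hul => ?_⟩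
  · obtain ⟨S', hS', L, hL, hlen, hE, hμ, hmin⟩ := h.node m hm
    simp only [chainLo, chainHi, h5, if_true]
    exact (hL.isChain_desc hE hμ hmin).mono hS'
  · obtain ⟨S', hS', L, hL, hlen, hE, hμ, hmin⟩ := h.node m hm
    have h1 := hL.length_le_ncard (hS.subset hS')
    have h2 := Set.ncard_le_ncard hS' hS
    simp only [chainLo, chainHi, h5, if_true]
    omega
  · obtain ⟨m, hm, S', hS', huS', L, hL, hlen, hE, hμ, hmin⟩ := h.cover u hu
    refine ⟨m, hm, .inl ?_⟩
    simp only [chainLo, chainHi, h5, if_true]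
    exact hL.exists_of_isLower (hS.subset hS') hE hμ hmin huS' (hul.mono hS')

theorem StoredCover.setup_neg (h : StoredCover s p S) (hS : S.Finite) (hk : S.ncard < 2 ^ k)
    (hco : Coord s (fun e => -p e) S) (h5 : s.ireg 5 = 1) : Setup s (fun e => -p e) S k := by
  have h5 : s.ireg 5 ≠ 0 := by omega
  refine ⟨hco, fun m hm => ?_, fun m hm => ?_, fun m hm => h.first_mem hm, fun u hu hul => ?_⟩
  · obtain ⟨S', hS', L, hL, hlen, hE, hμ, hmin⟩ := h.node m hm
    simp only [chainLo, chainHi, h5, if_false, hlen]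
    exact (hL.isChain_asc hE hμ hmin).mono hS'
  · obtain ⟨S', hS', L, hL, hlen, hE, hμ, hmin⟩ := h.node m hm
    have h1 := hL.length_le_ncard (hS.subset hS')
    have h2 := Set.ncard_le_ncard hS' hS
    simp only [chainLo, chainHi, h5, if_false]
    omega
  · obtain ⟨m, hm, S', hS', huS', L, hL, hlen, hE, hμ, hmin⟩ := h.cover u hu
    refine ⟨m, hm, ?_⟩
    simp only [IsCandidate, chainLo, chainHi, h5, if_false, hlen, neg_inj]
    exact (hL.exists_of_isLower_neg (hS.subset hS') hE hμ hmin huS' (hul.mono hS')).symm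

theorem StoredCover.congr {s' : State} (h : StoredCover s p S)
    (ha : ∀ a ≠ outArr, s'.iarr a = s.iarr a) (h6 : s'.ireg 6 = s.ireg 6) :
    StoredCover s' p S := by
  have key : ∀ S' m, StoredNode s p S' m → StoredNode s' p S' m := by
    intro S' m hm
    unfold StoredNode hullPos at *
    rw [ha nodeArr (by decide), ha hullLenArr (by decide), ha hullPosArr (by decide),
      ha hullMinArr (by decide), ha hullEventArr (by decide)]
    exact hm
  refine ⟨fun m hm => ?_, fun e he => ?_⟩
  · obtain ⟨S', hS', h'⟩ := h.node m (by omega)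
    exact ⟨S', hS', key _ _ h'⟩
  · obtain ⟨m, hm, S', hS', heS', h'⟩ := h.cover e he
    exact ⟨m, by omega, S', hS', heS', key _ _ h'⟩

end Stored

theorem length_le_hullSize {p : ℕ → ℝ × ℝ} {S : Set ℕ} (hS : S.Finite) {D : List ℕ}
    (hD : (D.map p).Nodup) (hmem : ∀ e ∈ D, p e ∈ hullVertices p S) :
    D.length ≤ hullSize p S := by
  have hfin : (hullVertices p S).Finite :=
    (hS.image p).subset extremePoints_convexHull_subset
  rw [← List.length_map p, ← List.toFinset_card_of_nodup hD, ← Set.ncard_coe_finset]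
  refine Set.ncard_le_ncard (fun z hz => ?_) hfin
  simp only [List.coe_toFinset, List.mem_map, Set.mem_ofPred_eq] at hz
  obtain ⟨e, he, rfl⟩ := hz
  exact hmem e he

/-- Prepare the output and the first phase. -/
def initLower : Prog :=
  .setI 5 (.const 0) ;; .storeI outArr (.const 0) (.reg 7) ;; .setI 9 (.const 1)

/-- Prepare the second phase. -/
def initUpper : Prog := .setR 0 (.const (-1)) ;; .setI 5 (.const 1)

/-- Determine the size of the output. -/
def finish : Prog :=
  .ite (.ilt (.const 1) (.reg 9)) (.setI 0 (.sub (.reg 9) (.const 1))) (.setI 0 (.reg 9))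

/-- List the convex hull of the window from the event in register `0` to that in register `1`. -/
def windowHull : Prog :=
  .setR 0 (.const 1) ;; collect ;; largest ;; initLower ;; phase ;; initUpper ;; phase ;; finish

/-- Bound for the number of steps of `windowHull`. -/
def windowHullCost (k c h : ℕ) : ℕ :=
  Prog.cost (.setR 0 (.const 1)) +
  ((collect.cost + (k + 1) * (takeLeft.cost + (takeRight.cost + goUp.cost) + 4)) +
  ((4 + (c + 1) * (largestBody.cost + 4)) + (initLower.cost +
  ((2 + (h + 1) * (findNextCost k c + phaseBody.cost + 4)) + (initUpper.cost +
  ((2 + (h + 1) * (findNextCost k c + phaseBody.cost + 4)) + finish.cost))))))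

theorem windowHullCost_mono {k c c' h : ℕ} (hc : c ≤ c') :
    windowHullCost k c h ≤ windowHullCost k c' h := by
  unfold windowHullCost findNextCost
  gcongr

theorem windowHullCost_le : ∃ C : ℕ, ∀ k h : ℕ, 1 ≤ h →
    windowHullCost k (2 * k + 1) h ≤ C * h * (k + 1) ^ 2 := by
  have hsq : ∀ k : ℕ, 1 ≤ (k + 1) ^ 2 := fun k => Nat.one_le_pow _ _ (by omega)
  have hlin : ∀ k : ℕ, k + 1 ≤ (k + 1) ^ 2 := fun k => Nat.le_self_pow (by omega) _
  have hfind : ∀ k, findNextCost k (2 * k + 1) ≤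
      (4 + 2 * (searchBody.cost + 4 + inspectNode.cost + 4)) * (k + 1) ^ 2 := by
    intro k
    have h1 := hsq k
    have h2 := hlin k
    unfold findNextCost inspectCost
    have h3 := Nat.mul_le_mul_left (inspectNode.cost + 4) h2
    nlinarith
  generalize searchBody.cost + 4 + inspectNode.cost + 4 = a at hfind
  have hconst : ∀ (x k h : ℕ), 1 ≤ h → x ≤ x * (h * (k + 1) ^ 2) := fun x k h hh =>
    Nat.le_mul_of_pos_right _ (Nat.mul_pos hh (hsq k))
  have hk : ∀ (x k h : ℕ), 1 ≤ h → (k + 1) * x ≤ x * (h * (k + 1) ^ 2) := by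
    intro x k h hh
    rw [Nat.mul_comm]
    exact Nat.mul_le_mul_left _ ((hlin k).trans (Nat.le_mul_of_pos_left _ hh))
  have hphase : ∀ (k h : ℕ), 1 ≤ h →
      (h + 1) * (findNextCost k (2 * k + 1) + phaseBody.cost + 4) ≤
        2 * (4 + 2 * a + (phaseBody.cost + 4)) * (h * (k + 1) ^ 2) := by
    intro k h hh
    have h1 : findNextCost k (2 * k + 1) + phaseBody.cost + 4 ≤
        (4 + 2 * a + (phaseBody.cost + 4)) * (k + 1) ^ 2 := by
      rw [Nat.add_mul, Nat.add_assoc]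
      exact Nat.add_le_add (hfind k) (Nat.le_mul_of_pos_right _ (hsq k))
    calc (h + 1) * _ ≤ (2 * h) * ((4 + 2 * a + (phaseBody.cost + 4)) * (k + 1) ^ 2) :=
          Nat.mul_le_mul (by omega) h1
      _ = _ := by ring
  generalize he : takeLeft.cost + (takeRight.cost + goUp.cost) + 4 = b at *
  refine ⟨Prog.cost (.setR 0 (.const 1)) + collect.cost + b + 4 + 2 * (largestBody.cost + 4) +
    initLower.cost + 2 + 2 * (4 + 2 * a + (phaseBody.cost + 4)) + initUpper.cost + 2 +
    2 * (4 + 2 * a + (phaseBody.cost + 4)) + finish.cost, fun k h hh => ?_⟩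
  unfold windowHullCost
  rw [he]
  have e1 := hconst (Prog.cost (.setR 0 (.const 1))) k h hh
  have e2 := hconst collect.cost k h hh
  have e3 := hk b k h hh
  have e4 := hk (2 * (largestBody.cost + 4)) k h hh
  have e5 := hconst initLower.cost k h hh
  have e6 := hphase k h hh
  have e7 := hconst initUpper.cost k h hh
  have e8 := hconst finish.cost k h hh
  have e9 := hconst 2 k h hh
  rw [Nat.mul_assoc]
  generalize h * (k + 1) ^ 2 = X at *
  linarith

theorem windowHull_runs {n : ℕ} {p : ℕ → ℝ × ℝ} {addr : ℕ → ℕ → ℕ} {s : State} {i j k : ℕ}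
    (hs : StoresDecomposition s n p addr) (hij : i ≤ j) (hj : j < n) (h0 : s.ireg 0 = i)
    (h1 : s.ireg 1 = j) (hk : j + 1 - i < 2 ^ k) :
    Runs windowHull s (windowHullCost k (2 * k + 1) (hullSize p (Set.Icc i j))) fun s' =>
      (∀ a < outArr, s'.iarr a = s.iarr a) ∧ s'.rarr = s.rarr ∧
      ∃ L : List ℕ, IsHullList p (Set.Icc i j) L ∧ s'.ireg 0 = L.length ∧
        ∀ (m : ℕ) (hm : m < L.length), s'.iarr outArr m = L[m] := by
  set S := Set.Icc i j with hSdef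
  have hS : S.Finite := Set.finite_Icc i j
  have hcard : S.ncard < 2 ^ k := by
    rw [hSdef, ← Finset.coe_Icc, Set.ncard_coe_finset, Nat.card_Icc]
    exact hk
  set s₁ : State := { s with rreg := Function.update s.rreg 0 1 } with hs₁
  have hst : StoresDecomposition s₁ n p addr := ⟨hs.xcoord, hs.ycoord, hs.addr_inj, hs.leaf,
    hs.parent, hs.left, hs.right, hs.next, hs.prev, hs.hull⟩
  have hrun := collect_runs hst hij hj h0 h1 (k := k) (by omega)
  -- This run is extracted in advance, because the bounds for what follows depend on the number of
  -- nodes that it collects. That number is at most `2 * k + 1`, and the cost is monotone in it.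
  obtain ⟨t₂, s₂, he₂, ht₂, ha₂, hr₂, hq₂, hi₂, hc₂, hcol⟩ := hrun
  refine Runs.mono ?_ (windowHullCost_mono hc₂) fun _ h => h
  have hco₂ : Coord s₂ p S := by
    intro e he
    rw [hr₂, hq₂]
    simp [hs₁, hs.xcoord e (lt_of_le_of_lt he.2 hj), hs.ycoord e (lt_of_le_of_lt he.2 hj)]
  have hcov₂ := hcol.storedCover hst ha₂
  have hlow : ∀ D : List ℕ, (D.Pairwise fun a b => toLex (p b) < toLex (p a)) →
      (∀ e ∈ D, e ∈ S ∧ IsLower p S (p e)) → D.length ≤ hullSize p S := fun D hD hmem =>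
    length_le_hullSize hS
      (List.pairwise_map.2 (hD.imp fun h he => h.ne (congrArg toLex he.symm)))
      fun e he => (hmem e he).2.mem_hullVertices hS (hmem e he).1
  have hupp : ∀ D : List ℕ, (D.Pairwise fun a b => toLex (-p b) < toLex (-p a)) →
      (∀ e ∈ D, e ∈ S ∧ IsLower (fun e => -p e) S (-p e)) → D.length ≤ hullSize p S :=
    fun D hD hmem => length_le_hullSize hS
      (List.pairwise_map.2 (hD.imp fun h he => h.ne (congrArg (toLex <| -·) he.symm)))
      fun e he => mem_hullVertices_of_isLower_neg hS (hmem e he).1 (hmem e he).2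
  refine Runs.seq (R₁ := fun s' => s' = s₁)
    (Prog.runs_of_wp _ _ _ (by simp [Prog.wp, RExp.val, hs₁])) ?_
  rintro _ rfl
  refine Runs.seq (R₁ := (s₂ = ·)) ⟨t₂, s₂, he₂, ht₂, rfl⟩ ?_
  rintro _ rfl
  refine Runs.seq (largest_runs hco₂ (by rw [hi₂ 0 (by omega)]; exact h0 ▸ ⟨le_rfl, hij⟩)
    (fun m hm => hcov₂.first_mem hm) (fun e he => hcov₂.exists_le_first he)) ?_
  rintro s₃ ⟨K₃, hm₃, hmax⟩
  refine Runs.seq (R₁ := fun s' => (∀ a ≠ outArr, s'.iarr a = s₂.iarr a) ∧ s'.rarr = s₂.rarr ∧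
    s'.rreg = s₂.rreg ∧ s'.ireg 5 = 0 ∧ s'.ireg 6 = s₂.ireg 6 ∧ s'.ireg 7 = s₃.ireg 7 ∧
    Out s' [s₃.ireg 7]) (Prog.runs_of_wp _ _ _ ?_) ?_
  · refine ⟨fun a ha => ?_, K₃.rarr, K₃.rreg, ?_⟩
    · exact (Function.update_of_ne ha _ _).trans (by rw [K₃.iarr])
    · simp [IExp.val, K₃.ireg, Out]
  rintro s₄ ⟨ha₄, hr₄, hq₄, e5, e6, e7, hO₄⟩
  have hcov₄ : StoredCover s₄ p S := hcov₂.congr ha₄ e6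
  have hco₄ : Coord s₄ p S := by
    intro e he
    rw [hq₄, hr₄]
    exact hco₂ e he
  have hph := phase_runs hS (hcov₄.setup hS hcard hco₄ e5) (by rwa [e7]) (by rwa [e7]) hO₄ hlow
  rw [e6] at hph
  refine Runs.seq hph ?_
  rintro s₅ ⟨A₅, D₁, hO₅, hD₁, hmin₅⟩
  rw [e7] at hD₁
  refine Runs.seq (R₁ := fun s' => s'.iarr = s₅.iarr ∧ s'.rarr = s₅.rarr ∧
    s'.rreg 0 = -1 ∧ s'.ireg 5 = 1 ∧ s'.ireg 6 = s₅.ireg 6 ∧ s'.ireg 7 = s₅.ireg 7 ∧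
    Out s' ([s₃.ireg 7] ++ D₁)) (Prog.runs_of_wp _ _ _ ?_) ?_
  · refine ⟨rfl, rfl, ?_⟩
    simp [IExp.val, RExp.val]
    simpa [Out] using hO₅
  rintro s₆ ⟨i₆, r₆, q0, f5, f6, f7, hO₆⟩
  have ha₆ : ∀ a ≠ outArr, s₆.iarr a = s₂.iarr a := fun a ha =>
    (congrFun i₆ a).trans ((A₅.iarr a ha).trans (ha₄ a ha))
  have hr₆ : s₆.rarr = s₂.rarr := (r₆.trans A₅.rarr).trans hr₄
  have f6' : s₆.ireg 6 = s₂.ireg 6 := (f6.trans (A₅.ireg 6 (by omega))).trans e6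
  have hcov₆ : StoredCover s₆ p S := hcov₂.congr ha₆ f6'
  have hco₆ : Coord s₆ (fun e => -p e) S := by
    intro e he
    rw [q0, hr₆, hr₂]
    simp [hs₁, hs.xcoord e (lt_of_le_of_lt he.2 hj), hs.ycoord e (lt_of_le_of_lt he.2 hj)]
  have hneg : ∀ {a b : ℝ × ℝ}, toLex (-a) ≤ toLex (-b) ↔ toLex b ≤ toLex a := by
    intro a b
    rw [← not_lt, toLex_neg_lt, not_lt]
  -- The smallest event, where the first march ended, is the largest one for the negated points and
  -- hence a valid start.
  have hph := phase_runs hS (hcov₆.setup_neg hS hcard hco₆ f5)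
    (by rw [f7]; exact (hD₁.mem _ hD₁.last_mem).1)
    (fun e he => by rw [f7]; exact hneg.2 (hmin₅ e he)) hO₆ hupp
  rw [f6'] at hph
  refine Runs.seq hph ?_
  rintro s₇ ⟨A₇, D₂, hO₇, hD₂, hmax₇⟩
  rw [f7] at hD₂
  have hmax₇ : ∀ e ∈ S, toLex (p e) ≤ toLex (p (s₇.ireg 7)) := fun e he => hneg.1 (hmax₇ e he)
  have hL := isHullList_of_lowerPrefix hS hD₁ hmax hmin₅ hD₂ hmax₇
  refine Prog.runs_of_wp _ _ _ ?_
  have hmem : (∀ a < outArr, s₇.iarr a = s.iarr a) ∧ s₇.rarr = s.rarr := by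
    refine ⟨fun a ha => ?_, (A₇.rarr.trans hr₆).trans hr₂⟩
    rw [A₇.iarr a (ne_of_lt ha), ha₆ a (ne_of_lt ha), ha₂ a (by unfold nodeArr outArr at *; omega)]
  have hlen : s₇.ireg 9 = D₁.length + 1 + D₂.length := by
    rw [hO₇.1]
    simp only [List.length_append, List.length_singleton]
    omega
  have hout : ∀ (m : ℕ) (hm : m < (s₃.ireg 7 :: D₁ ++ D₂.dropLast).length),
      s₇.iarr outArr m = (s₃.ireg 7 :: D₁ ++ D₂.dropLast)[m] := by
    intro m hm
    have hsub : s₃.ireg 7 :: D₁ ++ D₂.dropLast <+: [s₃.ireg 7] ++ D₁ ++ D₂ := by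
      rw [List.singleton_append, List.prefix_append_right_inj]
      exact List.dropLast_prefix D₂
    rw [hO₇.2 m (hm.trans_le hsub.length_le)]
    exact (hsub.getElem hm).symm
  simp only [finish, Prog.wp, BExp.holds, IExp.val]
  refine ⟨fun hlt => ⟨hmem.1, hmem.2, _, hL, ?_, hout⟩,
    fun hge => ⟨hmem.1, hmem.2, _, hL, ?_, hout⟩⟩
  · have hne : D₂ ≠ [] := by
      rintro rfl
      rw [eq_nil_of_lowerPrefix hD₁ hmin₅ hD₂ hmax₇] at hlen
      simp at hlen
      omega
    have := List.length_pos_iff.2 hne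
    simp only [Function.update_self, hlen, List.length_append, List.length_cons,
      List.length_dropLast]
    omega
  · have h2 : D₂.length = 0 := by omega
    simp only [Function.update_self, hlen, List.length_append, List.length_cons,
      List.length_dropLast]
    omega

end WindowHull

/-! ### The bound in terms of the window length -/

theorem mainTheorem5 :
    ∃ (Q : RealRAM.Prog) (K : ℝ),
      ∀ (n : ℕ) (p : ℕ → ℝ × ℝ) (addr : ℕ → ℕ → ℕ) (s : RealRAM.State),
        WindowHull.StoresDecomposition s n p addr →
        ∀ i j : ℕ, i ≤ j → j < n → s.ireg 0 = i → s.ireg 1 = j →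
          ∃ (t : ℕ) (s' : RealRAM.State) (L : List ℕ),
            RealRAM.Exec Q s t s' ∧
            WindowHull.IsHullList p (Set.Icc i j) L ∧
            s'.ireg 0 = L.length ∧
            (∀ (m : ℕ) (hm : m < L.length), s'.iarr WindowHull.outArr m = L[m]) ∧
            (∀ a < WindowHull.outArr, s'.iarr a = s.iarr a) ∧
            s'.rarr WindowHull.xArr = s.rarr WindowHull.xArr ∧
            s'.rarr WindowHull.yArr = s.rarr WindowHull.yArr ∧
            (t : ℝ) ≤ K * (WindowHull.hullSize p (Set.Icc i j) : ℝ) *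
              (1 + Real.logb 2 ((j + 1 - i : ℕ) : ℝ)) ^ 2 := by
  obtain ⟨C, hC⟩ := WindowHull.windowHullCost_le
  -- With `k = ⌊log₂ w⌋` the window length is below `2 ^ (k + 1)`, which gives the factor `(k + 2) ^
  -- 2 ≤ 4 * (1 + log₂ w) ^ 2`.
  refine ⟨WindowHull.windowHull, C * 4, fun n p addr s hs i j hij hj h0 h1 => ?_⟩
  have hk : j + 1 - i < 2 ^ (Nat.log 2 (j + 1 - i) + 1) := Nat.lt_pow_succ_log_self (by omega) _
  obtain ⟨t, s', he, ht, ha, hr, L, hL, hlen, hout⟩ :=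
    WindowHull.windowHull_runs hs hij hj h0 h1 hk
  refine ⟨t, s', L, he, hL, hlen, hout, ha, by rw [hr], by rw [hr], ?_⟩
  -- Needed to absorb the additive costs into a multiple of `h`; a nonempty compact convex set has
  -- an extreme point.
  have hh : 1 ≤ WindowHull.hullSize p (Set.Icc i j) := by
    have hfin : (p '' Set.Icc i j).Finite := (Set.finite_Icc i j).image p
    have hne : (WindowHull.hullVertices p (Set.Icc i j)).Nonempty :=
      (hfin.isCompact_convexHull ℝ).extremePoints_nonempty
        (Set.Nonempty.convexHull ⟨p i, i, ⟨le_rfl, hij⟩, rfl⟩)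
    exact (Set.ncard_pos (hfin.subset extremePoints_convexHull_subset)).2 hne
  have hlog : (Nat.log 2 (j + 1 - i) : ℝ) ≤ Real.logb 2 ((j + 1 - i : ℕ) : ℝ) := by
    exact_mod_cast Real.natLog_le_logb (j + 1 - i) 2
  set k := Nat.log 2 (j + 1 - i)
  set x := Real.logb 2 ((j + 1 - i : ℕ) : ℝ)
  have hbound := ht.trans (hC (k + 1) _ hh)
  have hk0 : (0 : ℝ) ≤ k := Nat.cast_nonneg k
  calc (t : ℝ) ≤ C * WindowHull.hullSize p (Set.Icc i j) * ((k : ℝ) + 1 + 1) ^ 2 := by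
        exact_mod_cast hbound
    _ ≤ C * WindowHull.hullSize p (Set.Icc i j) * (2 * (1 + x)) ^ 2 := by
        gcongr
        linarith
    _ = _ := by ring
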